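/- There exist a probability space, an i.i.d. sequence $(Y_i)_{i\in\mathbb Z}$ of standard normal random variables on it, square summable coefficients $t_i\ge 0$ $(i\ge 0)$, a strictly stationary, Gaussian, positively associated linear process $$X_k=\sum_{i=0}^{\infty}t_iY_{k-i},\qquad k\in\mathbb Z$$ (the series converging almost surely and in $L_2$), and a non-decreasing filtration $(\mathcal F_k)_{k\in\mathbb Z}$ of $\sigma$-fields such that, with $\mathcal F_{-\infty}=\bigcap_{i\in\mathbb Z}\mathcal F_i$, $P_j(Z)=E(Z\mid\mathcal F_j)-E(Z\mid\mathcal F_{j-1})$, $\|Z\|=\sqrt{E(Z^2)}$, $S_n=X_1+\dots+X_n$ and $\sigma_n^2=\mathrm{Var}(S_n)$, the following hold. (i) $X_k$ is $\mathcal F_k$-measurable for every $k\in\mathbb Z$. (ii) $E(X_k\mid\mathcal F_{-\infty})=0$ a.s. for every $k\in\mathbb Z$. (iii) $\sup_{k\ge 0}\sum_{j\in\mathbb Z}\|P_j(X_k)\|<\infty$. (iv) $\sigma_n^2>0$ for all $n\ge 1$, and $\sigma_n^2$ is not regularly varying with index $1$ (that is, it is not true that $\sigma_{[an]}^2/\sigma_n^2\to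 a$ as $n\to\infty$ for every $a>0$). More exactly, there are a constant $c>0$ and a strictly increasing sequence of integers $k_n\ge 2$ such that $\mathrm{Var}(S_{k_n})\ge c\,k_n^2/\ln^4(k_n)$ for all $n$. (v) $\sigma_n^{-1}S_{[nt]}$, $0\le t\le 1$, does not satisfy the invariance principle, i.e. it does not converge weakly, in the space $D[0,1]$ of cadlag functions with the uniform topology, to a standard Brownian motion on $[0,1]$. -/

import Mathlib

open MeasureTheory ProbabilityTheory Filter
open scoped Topology ENNReal NNReal

namespace ShortMemory

/-! ### Processes indexed by the integers -/

section Processes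

variable {Ω : Type*} {mΩ : MeasurableSpace Ω}

/-- `X` is the causal linear process `X_k = ∑_{i ≥ 0} t_i Y_{k-i}` with square summable
coefficients `t`, the series converging both almost surely and in `L²(μ)`. -/
structure IsCausalLinearProcess (μ : Measure Ω) (t : ℕ → ℝ) (Y X : ℤ → Ω → ℝ) : Prop where
  summable_sq : Summable fun i => t i ^ 2
  ae_tendsto : ∀ k : ℤ, ∀ᵐ ω ∂μ,
    Tendsto (fun n : ℕ => ∑ i ∈ Finset.range n, t i * Y (k - i) ω) atTop (𝓝 (X k ω))
  tendsto_eLpNorm : ∀ k : ℤ,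
    Tendsto (fun n : ℕ =>
      eLpNorm (fun ω => (∑ i ∈ Finset.range n, t i * Y (k - i) ω) - X k ω) 2 μ) atTop (𝓝 0)

/-- Strict stationarity: the law of the whole process is invariant under every time shift. -/
def IsStrictlyStationary (μ : Measure Ω) (X : ℤ → Ω → ℝ) : Prop :=
  ∀ h : ℤ, IdentDistrib (fun ω (k : ℤ) => X (k + h) ω) (fun ω (k : ℤ) => X k ω) μ μ

/-- Positive association: for every finite set `I` of times, all coordinatewise nondecreasing
functions of `(X_k)_{k ∈ I}` whose covariance exists are nonnegatively correlated. -/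
def IsPositivelyAssociated (μ : Measure Ω) (X : ℤ → Ω → ℝ) : Prop :=
  ∀ (I : Finset ℤ) (f g : (I → ℝ) → ℝ),
    Monotone f → Monotone g → Measurable f → Measurable g →
    Integrable (fun ω => f fun k => X k ω) μ →
    Integrable (fun ω => g fun k => X k ω) μ →
    Integrable (fun ω => (f fun k => X k ω) * (g fun k => X k ω)) μ →
    0 ≤ cov[fun ω => f fun k => X k ω, fun ω => g fun k => X k ω; μ]

/-- The projection operator `P_j(Z) = E(Z | F_j) - E(Z | F_{j-1})`. -/
noncomputable def proj (μ : Measure Ω) (F : Filtration ℤ mΩ) (j : ℤ) (Z : Ω → ℝ) : Ω → ℝ :=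
  μ[Z | F j] - μ[Z | F (j - 1)]

/-- The partial sums `S_n = X_1 + ... + X_n`. -/
def partialSum (X : ℤ → Ω → ℝ) (n : ℕ) (ω : Ω) : ℝ :=
  ∑ k ∈ Finset.Icc 1 n, X (k : ℤ) ω

/-- The standard deviation `σ_n` of `S_n`. -/
noncomputable def sigma (μ : Measure Ω) (X : ℤ → Ω → ℝ) (n : ℕ) : ℝ :=
  Real.sqrt (variance (partialSum X n) μ)

end Processes

/-- An (eventually) positive sequence `c` is regularly varying with index `ρ` if
`c_{[an]} / c_n → a ^ ρ` for every `a > 0`. -/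
def IsRegularlyVarying (c : ℕ → ℝ) (ρ : ℝ) : Prop :=
  (∀ᶠ n in atTop, 0 < c n) ∧
    ∀ a : ℝ, 0 < a → Tendsto (fun n : ℕ => c ⌊a * (n : ℝ)⌋₊ / c n) atTop (𝓝 (a ^ ρ))

/-! ### The space `D[0,1]` with the uniform topology -/

/-- Right continuous with left limits, on `[0,1]` (at `0` the left limit is no condition). -/
def IsCadlag (x : unitInterval → ℝ) : Prop :=
  ∀ t, ContinuousWithinAt x (Set.Ici t) t ∧ ∃ l : ℝ, Tendsto x (𝓝[<] t) (𝓝 l)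

open scoped UniformConvergence in
/-- The space `D[0,1]` of cadlag functions, with the topology of uniform convergence (the
subspace topology from all functions `[0,1] → ℝ` with the uniform convergence topology). -/
abbrev DSpace : Type :=
  {x : unitInterval →ᵤ ℝ // IsCadlag (UniformFun.toFun x)}

theorem isCadlag_floor (a : ℕ → ℝ) (n : ℕ) :
    IsCadlag fun t : unitInterval => a ⌊(n : ℝ) * (t : ℝ)⌋₊ := by
  have key : (fun t : unitInterval => a ⌊(n : ℝ) * (t : ℝ)⌋₊) =
      fun t : unitInterval => a (⌊(n : ℝ) * (t : ℝ)⌋).toNat := by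
    funext t
    rw [Int.floor_toNat]
  rw [key]
  have hc : Continuous fun t : unitInterval => (n : ℝ) * (t : ℝ) := by fun_prop
  have hn : (0 : ℝ) ≤ n := Nat.cast_nonneg n
  intro t
  constructor
  · have h1 : Tendsto (fun s : unitInterval => (n : ℝ) * (s : ℝ)) (𝓝[≥] t)
        (𝓝[≥] ((n : ℝ) * (t : ℝ))) := by
      refine tendsto_nhdsWithin_iff.2 ⟨hc.continuousWithinAt, ?_⟩
      filter_upwards [self_mem_nhdsWithin] with s hs
      exact mul_le_mul_of_nonneg_left (Subtype.coe_le_coe.2 hs) hn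
    have h2 := (tendsto_floor_right_pure_floor ((n : ℝ) * (t : ℝ))).comp h1
    refine Tendsto.congr' ?_ tendsto_const_nhds
    filter_upwards [tendsto_pure.1 h2] with s hs
    simp only [Function.comp] at hs
    rw [hs]
  · rcases Nat.eq_zero_or_pos n with rfl | hpos
    · exact ⟨a 0, by simpa using tendsto_const_nhds⟩
    · have hpos' : (0 : ℝ) < n := Nat.cast_pos.2 hpos
      have h1 : Tendsto (fun s : unitInterval => (n : ℝ) * (s : ℝ)) (𝓝[<] t)
          (𝓝[<] ((n : ℝ) * (t : ℝ))) := by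
        refine tendsto_nhdsWithin_iff.2 ⟨hc.continuousWithinAt, ?_⟩
        filter_upwards [self_mem_nhdsWithin] with s hs
        exact mul_lt_mul_of_pos_left (Subtype.coe_lt_coe.2 hs) hpos'
      have h2 := (tendsto_floor_left_pure_ceil_sub_one ((n : ℝ) * (t : ℝ))).comp h1
      refine ⟨a (⌈(n : ℝ) * (t : ℝ)⌉ - 1).toNat, Tendsto.congr' ?_ tendsto_const_nhds⟩
      filter_upwards [tendsto_pure.1 h2] with s hs
      simp only [Function.comp] at hs
      rw [hs]

/-- The element `t ↦ a_{[nt]}` of `D[0,1]`. -/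
noncomputable def stepPath (a : ℕ → ℝ) (n : ℕ) : DSpace :=
  ⟨UniformFun.ofFun fun t : unitInterval => a ⌊(n : ℝ) * (t : ℝ)⌋₊, isCadlag_floor a n⟩

/-- The random element `t ↦ σ_n⁻¹ S_{[nt]}` of `D[0,1]`. -/
noncomputable def normalizedPath {Ω : Type*} {mΩ : MeasurableSpace Ω} (μ : Measure Ω)
    (X : ℤ → Ω → ℝ) (n : ℕ) (ω : Ω) : DSpace :=
  stepPath (fun m => (sigma μ X n)⁻¹ * partialSum X m ω) n

/-- `W`, with values in `D[0,1]`, is a standard Brownian motion on `[0,1]`: almost surely it is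
the restriction to `[0,1]` of a standard Brownian motion on `[0,∞)`. -/
def IsBrownianInD {Ω' : Type*} {mΩ' : MeasurableSpace Ω'} (ν : Measure Ω') (W : Ω' → DSpace) :
    Prop :=
  ∃ B : ℝ≥0 → Ω' → ℝ, IsBrownianReal B ν ∧
    ∀ᵐ ω ∂ν, ∀ t : unitInterval, UniformFun.toFun (W ω).1 t = B (unitInterval.toNNReal t) ω

/-- Weak convergence in `D[0,1]`: expectations of bounded continuous functionals converge. -/
def ConvergesWeakly {Ω Ω' : Type*} {mΩ : MeasurableSpace Ω} {mΩ' : MeasurableSpace Ω'}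
    (μ : Measure Ω) (Z : ℕ → Ω → DSpace) (ν : Measure Ω') (W : Ω' → DSpace) : Prop :=
  ∀ f : BoundedContinuousFunction DSpace ℝ,
    Tendsto (fun n => ∫ ω, f (Z n ω) ∂μ) atTop (𝓝 (∫ ω, f (W ω) ∂ν))

/-- The invariance principle for `σ_n⁻¹ S_{[nt]}`: weak convergence in `D[0,1]` to a standard
Brownian motion. -/
def InvariancePrinciple {Ω : Type*} {mΩ : MeasurableSpace Ω} (μ : Measure Ω)
    (X : ℤ → Ω → ℝ) : Prop :=
  ∃ (Ω' : Type) (_ : MeasurableSpace Ω') (ν : Measure Ω') (W : Ω' → DSpace),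
    IsProbabilityMeasure ν ∧ IsBrownianInD ν W ∧ ConvergesWeakly μ (normalizedPath μ X) ν W

end ShortMemory

namespace ShortMemory

/-! ### Harris' inequality on an infinite product of copies of a law on the line -/

section Harris

variable {ι : Type*} {ν : Measure ℝ} [IsProbabilityMeasure ν]

/-! The example rests on the freedom to choose the filtration in (iii). The projections of `X k`
vanish whenever the filtration stands still, so a filtration that moves only at the points of a very
sparse grid makes the sum of their norms small, however slowly the coefficients decay. It always
sees at least the noise up to the present, hence adaptedness. A move far in the past of `k` costs at
most twice the square root of a tail of `∑ t i ^ 2`. The gaps of the grid are chosen so that these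
costs decay geometrically, and only the two grid intervals nearest to `k` need the trivial bound
(`exists_gaps`, `sqrt_tailSq_grid_le`, `tsum_eLpNorm_proj_le`).

Square summability is therefore the only constraint on `t`, and `coeff` is barely square summable.
Cauchy–Schwarz against a sum of past innovations gives `Var S_n ≥ n³ t_{2n}²`
(`le_variance_partialSum`), which is of order `n² / ln² n`. If `Var S_{2n} / Var S_n` tended to 2,
the variance would grow at most like `3^r` along `2^r N`, whereas the lower bound is `4^r` up to a
power of `r` (`not_tendsto_ratio_two`). This excludes regular variation with index 1. It also
excludes the invariance principle, since Gaussianity turns convergence of the time-1/2 marginal into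
convergence of the variance ratio to 1/2.

Positive association follows from Harris' inequality for infinitely many independent variables,
since the process is nondecreasing in each innovation when `t ≥ 0`. -/

theorem measurePreserving_precomp {α β : Type*} {f : α → β} (hf : Function.Injective f) :
    MeasurePreserving (fun (ω : β → ℝ) a => ω (f a))
      (Measure.infinitePi fun _ : β => ν) (Measure.infinitePi fun _ : α => ν) :=
  ⟨by fun_prop, Measure.map_infinitePi_infinitePi_of_inj hf⟩

theorem integral_precomp {α β : Type*} {f : α → β} (hf : Function.Injective f)
    {g : (α → ℝ) → ℝ} (hg : Measurable g) :
    ∫ ω, g (fun a => ω (f a)) ∂(Measure.infinitePi fun _ : β => ν) =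
      ∫ ω, g ω ∂(Measure.infinitePi fun _ : α => ν) := by
  have h := measurePreserving_precomp (ν := ν) hf
  rw [← h.map_eq, integral_map h.measurable.aemeasurable hg.aestronglyMeasurable]

theorem indepFun_inl_inr :
    IndepFun (fun (ω : ι ⊕ ι → ℝ) i => ω (.inl i)) (fun (ω : ι ⊕ ι → ℝ) i => ω (.inr i))
      (Measure.infinitePi fun _ : ι ⊕ ι => ν) := by
  have h : iIndepFun (fun (i : ι ⊕ ι) (ω : ι ⊕ ι → ℝ) => ω i)
      (Measure.infinitePi fun _ : ι ⊕ ι => ν) :=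
    iIndepFun_infinitePi (X := fun _ x => x) (fun _ => measurable_id)
  have h2 := indep_iSup_of_disjoint (fun i => (measurable_pi_apply i).comap_le) h
    (Set.isCompl_range_inl_range_inr (α := ι) (β := ι)).disjoint
  rw [iSup_range, iSup_range] at h2
  have e : ∀ f : ι → ι ⊕ ι, MeasurableSpace.comap (fun (ω : ι ⊕ ι → ℝ) i => ω (f i))
      MeasurableSpace.pi = ⨆ i, MeasurableSpace.comap (fun ω => ω (f i)) inferInstance := by
    intro f
    simp only [MeasurableSpace.pi, MeasurableSpace.comap_iSup, MeasurableSpace.comap_comp,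
      Function.comp_def]
  rw [IndepFun_iff_Indep, e, e]
  exact h2

/-- Monotonicity with respect to modifications of a single coordinate. -/
def MonotoneUpdate [DecidableEq ι] (F : (ι → ℝ) → ℝ) : Prop :=
  ∀ ω i x, ω i ≤ x → F ω ≤ F (Function.update ω i x)

theorem MonotoneUpdate.update_le [DecidableEq ι] {F : (ι → ℝ) → ℝ} (hF : MonotoneUpdate F)
    (ω : ι → ℝ) (i : ι) {x : ℝ} (hx : x ≤ ω i) : F (Function.update ω i x) ≤ F ω := by
  have := hF (Function.update ω i x) i (ω i) (by simpa using hx)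
  simpa using this

/-- Resampling of the coordinates in `S`: the coordinate is read in the second copy. -/
def resample [DecidableEq ι] (S : Finset ι) (i : ι) : ι ⊕ ι := if i ∈ S then .inr i else .inl i

theorem resample_injective [DecidableEq ι] (S : Finset ι) : Function.Injective (resample S) := by
  intro i j h
  unfold resample at h
  split_ifs at h <;> simp_all

variable {F G : (ι → ℝ) → ℝ} {C : ℝ}

theorem integrable_of_bounded {Ω : Type*} {mΩ : MeasurableSpace Ω} {μ : Measure Ω}
    [IsFiniteMeasure μ] {f : Ω → ℝ} (hf : Measurable f) (h : ∀ ω, |f ω| ≤ C) : Integrable f μ :=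
  Integrable.of_bound hf.aestronglyMeasurable C (Eventually.of_forall h)

/-- Exchanging the two copies of coordinate `i` preserves the law. Averaging the difference of the
two integrands over this exchange leaves a product of the increments of `F` and `G` caused by the
same change of one coordinate, and these have the same sign. -/
theorem integral_mul_resample_insert_le [DecidableEq ι] (hF : Measurable F) (hG : Measurable G)
    (hFm : MonotoneUpdate F) (hGm : MonotoneUpdate G) (hFC : ∀ ω, |F ω| ≤ C)
    (hGC : ∀ ω, |G ω| ≤ C) {S : Finset ι} {i : ι} (hi : i ∉ S) :
    ∫ ω, F (fun j => ω (.inl j)) * G (fun j => ω (resample (insert i S) j))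
        ∂(Measure.infinitePi fun _ : ι ⊕ ι => ν) ≤
      ∫ ω, F (fun j => ω (.inl j)) * G (fun j => ω (resample S j))
        ∂(Measure.infinitePi fun _ : ι ⊕ ι => ν) := by
  set P := Measure.infinitePi fun _ : ι ⊕ ι => ν
  have hC : 0 ≤ C := (abs_nonneg _).trans (hFC 0)
  have hint : ∀ T, Integrable
      (fun ω => F (fun j => ω (.inl j)) * G (fun j => ω (resample T j))) P := by
    intro T
    refine integrable_of_bounded (C := C * C) (by fun_prop) fun ω => ?_
    rw [abs_mul]
    exact mul_le_mul (hFC _) (hGC _) (abs_nonneg _) hC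
  set H : (ι ⊕ ι → ℝ) → ℝ := fun ω => F (fun j => ω (.inl j)) *
    (G (fun j => ω (resample S j)) - G (fun j => ω (resample (insert i S) j))) with hH
  have hHm : Measurable H := by fun_prop
  let σ : Equiv.Perm (ι ⊕ ι) := Equiv.swap (.inl i) (.inr i)
  have hσ := measurePreserving_precomp (ν := ν) σ.injective
  have hHint : Integrable H P := by
    refine ((hint S).sub (hint (insert i S))).congr (Eventually.of_forall fun ω => ?_)
    simp [hH, mul_sub]
  have h1 : ∫ ω, H (fun j => ω (σ j)) ∂P = ∫ ω, H ω ∂P :=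
    integral_precomp σ.injective hHm
  -- The swap exchanges the two `G` terms and updates coordinate `i` in `F`. Hence the sum is (`F`
  -- minus updated `F`) times (`G` minus updated `G`).
  have h2 : 0 ≤ ∫ ω, (H ω + H (fun j => ω (σ j))) ∂P := by
    refine integral_nonneg fun ω => ?_
    have e1 : (fun j => ω (σ (.inl j))) = Function.update (fun j => ω (.inl j)) i (ω (.inr i)) := by
      funext j
      rcases eq_or_ne j i with rfl | hj
      · simp [σ]
      · simp only [σ, Function.update_of_ne hj]
        rw [Equiv.swap_apply_of_ne_of_ne] <;> simp [hj]
    have e2 : (fun j => ω (resample (insert i S) j)) =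
        Function.update (fun j => ω (resample S j)) i (ω (.inr i)) := by
      funext j
      rcases eq_or_ne j i with rfl | hj
      · simp [resample]
      · simp [resample, hj]
    have e3 : (fun j => ω (σ (resample S j))) = fun j => ω (resample (insert i S) j) := by
      funext j
      rcases eq_or_ne j i with rfl | hj
      · simp [resample, σ, hi]
      · by_cases hS : j ∈ S
        · simp only [resample, hS, hj, σ, if_true, Finset.mem_insert, or_true]
          rw [Equiv.swap_apply_of_ne_of_ne] <;> simp [hj]
        · simp only [resample, hS, hj, σ, if_false, Finset.mem_insert, or_false]
          rw [Equiv.swap_apply_of_ne_of_ne] <;> simp [hj]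
    have e4 : (fun j => ω (σ (resample (insert i S) j))) = fun j => ω (resample S j) := by
      funext j
      rcases eq_or_ne j i with rfl | hj
      · simp [resample, σ, hi]
      · by_cases hS : j ∈ S
        · simp only [resample, hS, hj, σ, if_true, Finset.mem_insert, or_true]
          rw [Equiv.swap_apply_of_ne_of_ne] <;> simp [hj]
        · simp only [resample, hS, hj, σ, if_false, Finset.mem_insert, or_false]
          rw [Equiv.swap_apply_of_ne_of_ne] <;> simp [hj]
    simp only [hH, e1, e3, e4, e2, Pi.zero_apply]
    have hSi : (fun j => ω (resample S j)) i = ω (.inl i) := by simp [resample, hi]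
    rcases le_total (ω (.inl i)) (ω (.inr i)) with h | h
    · have a1 := hFm (fun j => ω (.inl j)) i _ h
      have a2 := hGm (fun j => ω (resample S j)) i (ω (.inr i)) (hSi.trans_le h)
      nlinarith
    · have a1 := hFm.update_le (fun j => ω (.inl j)) i h
      have a2 := hGm.update_le (fun j => ω (resample S j)) i (x := ω (.inr i)) (h.trans_eq hSi.symm)
      nlinarith
  have h4 := integral_add hHint (hσ.integrable_comp_of_integrable hHint)
  simp only [Function.comp_def] at h4
  rw [h4, h1] at h2
  have h3 : ∫ ω, H ω ∂P = _ := integral_congr_ae (Eventually.of_forall fun ω => mul_sub _ _ _)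
  rw [h3, integral_sub (hint S) (hint (insert i S))] at h2
  linarith

theorem integral_mul_resample_le [DecidableEq ι] (hF : Measurable F) (hG : Measurable G)
    (hFm : MonotoneUpdate F) (hGm : MonotoneUpdate G) (hFC : ∀ ω, |F ω| ≤ C)
    (hGC : ∀ ω, |G ω| ≤ C) (S : Finset ι) :
    ∫ ω, F (fun j => ω (.inl j)) * G (fun j => ω (resample S j))
        ∂(Measure.infinitePi fun _ : ι ⊕ ι => ν) ≤
      ∫ ω, F ω * G ω ∂(Measure.infinitePi fun _ : ι => ν) := by
  induction S using Finset.induction_on with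
  | empty =>
    have h := measurePreserving_precomp (ν := ν) (Sum.inl_injective (α := ι) (β := ι))
    rw [← h.map_eq, integral_map h.measurable.aemeasurable
      (by exact (hF.mul hG).aestronglyMeasurable)]
    simp [resample]
  | insert i S hi ih =>
    exact (integral_mul_resample_insert_le hF hG hFm hGm hFC hGC hi).trans ih

/-- The filtration on `ι → ℝ` generated by an increasing sequence of finite sets of coordinates. -/
def finsetFiltration (s : ℕ → Finset ι) (hs : Monotone s) :
    Filtration ℕ (MeasurableSpace.pi : MeasurableSpace (ι → ℝ)) where
  seq n := Filtration.piFinset (X := fun _ : ι => ℝ) (s n)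
  mono' _ _ h := (Filtration.piFinset (X := fun _ : ι => ℝ)).mono (hs h)
  le' n := (Filtration.piFinset (X := fun _ : ι => ℝ)).le (s n)

theorem iSup_finsetFiltration (s : ℕ → Finset ι) (hs : Monotone s) (hcov : ∀ i, ∃ n, i ∈ s n) :
    (⨆ n, finsetFiltration s hs n) = (MeasurableSpace.pi : MeasurableSpace (ι → ℝ)) := by
  refine le_antisymm (iSup_le fun n => (finsetFiltration s hs).le n) ?_
  refine iSup_le fun i => ?_
  obtain ⟨n, hn⟩ := hcov i
  refine le_trans ?_ (le_iSup _ n)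
  have : (fun ω : ι → ℝ => ω i) = (fun x : s n → ℝ => x ⟨i, hn⟩) ∘ (s n).restrict := rfl
  rw [this, ← MeasurableSpace.comap_comp]
  exact MeasurableSpace.comap_mono (measurable_pi_apply _).comap_le

/-- Once every coordinate has been resampled, `G` reads a copy independent of the one read by `F`,
which yields the product of the integrals. Lévy's upward theorem reduces the limit to functions of
finitely many coordinates. -/
theorem tendsto_integral_mul_resample [DecidableEq ι] (hF : Measurable F) (hG : Measurable G)
    (hFC : ∀ ω, |F ω| ≤ C) (hGC : ∀ ω, |G ω| ≤ C)
    (s : ℕ → Finset ι) (hs : Monotone s) (hcov : ∀ i, ∃ n, i ∈ s n) :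
    Tendsto (fun n => ∫ ω, F (fun j => ω (.inl j)) * G (fun j => ω (resample (s n) j))
        ∂(Measure.infinitePi fun _ : ι ⊕ ι => ν)) atTop
      (𝓝 ((∫ ω, F ω ∂(Measure.infinitePi fun _ : ι => ν)) *
        ∫ ω, G ω ∂(Measure.infinitePi fun _ : ι => ν))) := by
  set P := Measure.infinitePi fun _ : ι ⊕ ι => ν
  set Q := Measure.infinitePi fun _ : ι => ν
  have hC : 0 ≤ C := (abs_nonneg _).trans (hFC 0)
  have hl := measurePreserving_precomp (ν := ν) (Sum.inl_injective (α := ι) (β := ι))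
  have hr := measurePreserving_precomp (ν := ν) (Sum.inr_injective (α := ι) (β := ι))
  have hprod : (∫ ω, F ω ∂Q) * ∫ ω, G ω ∂Q =
      ∫ ω, F (fun j => ω (.inl j)) * G (fun j => ω (.inr j)) ∂P := by
    have h := (indepFun_inl_inr (ι := ι) (ν := ν)).comp hF hG
    have h' := h.integral_fun_mul_eq_mul_integral
      (by exact (hF.comp hl.measurable).aestronglyMeasurable)
      (by exact (hG.comp hr.measurable).aestronglyMeasurable)
    simp only [Function.comp] at h'
    rw [h', integral_precomp Sum.inl_injective hF, integral_precomp Sum.inr_injective hG]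
  have hGint : Integrable G Q := integrable_of_bounded hG hGC
  set ℱ := finsetFiltration s hs
  have hlev := hGint.tendsto_eLpNorm_condExp (ℱ := ℱ)
    (by rw [iSup_finsetFiltration s hs hcov]; exact hG.stronglyMeasurable)
  have hlev' : Tendsto (fun n => 2 * C * ∫ ω, |(Q[G | ℱ n]) ω - G ω| ∂Q) atTop (𝓝 0) := by
    have : Tendsto (fun n => ∫ ω, |(Q[G | ℱ n]) ω - G ω| ∂Q) atTop (𝓝 0) := by
      have h := (ENNReal.tendsto_toReal ENNReal.zero_ne_top).comp hlev
      refine h.congr fun n => ?_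
      simp only [Function.comp]
      rw [eLpNorm_one_eq_lintegral_enorm,
        ← integral_norm_eq_lintegral_enorm (integrable_condExp.sub hGint).aestronglyMeasurable]
      rfl
    simpa using this.const_mul (2 * C)
  rw [tendsto_iff_dist_tendsto_zero]
  refine squeeze_zero (fun n => dist_nonneg) (fun n => ?_) hlev'
  set H := Q[G | ℱ n] with hHdef
  have hHm : Measurable H := stronglyMeasurable_condExp.measurable.mono (ℱ.le n) le_rfl
  have hHint : Integrable H Q := integrable_condExp
  have hHdep : DependsOn H (s n) :=
    StronglyMeasurable.dependsOn_of_piFinset (stronglyMeasurable_condExp (m := ℱ n))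
  -- `H` reads only coordinates in `s n`, all of them resampled, so it cannot distinguish partial
  -- from full resampling. Replacing `G` by `H` costs the same L¹ error under both maps, whence the
  -- factor `2 * C`.
  have hHeq : ∀ ω : ι ⊕ ι → ℝ, H (fun j => ω (resample (s n) j)) = H (fun j => ω (.inr j)) := by
    intro ω
    refine hHdep fun i hi => ?_
    simp [resample, Finset.mem_coe.1 hi]
  have hm := measurePreserving_precomp (ν := ν) (resample_injective (s n))
  have hDint : Integrable (fun ω => |H ω - G ω|) Q := (hHint.sub hGint).abs
  have hDm : Measurable fun ω => |H ω - G ω| := (hHm.sub hG).abs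
  have key : ∀ ω : ι ⊕ ι → ℝ, ‖F (fun j => ω (.inl j)) * G (fun j => ω (resample (s n) j)) -
      F (fun j => ω (.inl j)) * G (fun j => ω (.inr j))‖ ≤
      C * (|H (fun j => ω (resample (s n) j)) - G (fun j => ω (resample (s n) j))| +
        |H (fun j => ω (.inr j)) - G (fun j => ω (.inr j))|) := by
    intro ω
    rw [← mul_sub, Real.norm_eq_abs, abs_mul]
    refine mul_le_mul (hFC _) ?_ (abs_nonneg _) hC
    have h1 := abs_sub_le (G (fun j => ω (resample (s n) j))) (H (fun j => ω (resample (s n) j)))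
      (G (fun j => ω (.inr j)))
    rw [abs_sub_comm (G _) (H _)] at h1
    rw [hHeq] at h1 ⊢
    exact h1
  have hi1 : Integrable
      (fun ω => F (fun j => ω (.inl j)) * G (fun j => ω (resample (s n) j))) P := by
    refine integrable_of_bounded (C := C * C) (by fun_prop) fun ω => ?_
    rw [abs_mul]
    exact mul_le_mul (hFC _) (hGC _) (abs_nonneg _) hC
  have hi2 : Integrable (fun ω => F (fun j => ω (.inl j)) * G (fun j => ω (.inr j))) P := by
    refine integrable_of_bounded (C := C * C) (by fun_prop) fun ω => ?_
    rw [abs_mul]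
    exact mul_le_mul (hFC _) (hGC _) (abs_nonneg _) hC
  have hj1 := hm.integrable_comp_of_integrable hDint
  have hj2 := hr.integrable_comp_of_integrable hDint
  have hk1 : ∫ ω, |H (fun j => ω (resample (s n) j)) - G (fun j => ω (resample (s n) j))| ∂P =
      ∫ ω, |H ω - G ω| ∂Q :=
    integral_precomp (resample_injective (s n)) hDm
  have hk2 : ∫ ω, |H (fun j => ω (.inr j)) - G (fun j => ω (.inr j))| ∂P =
      ∫ ω, |H ω - G ω| ∂Q :=
    integral_precomp Sum.inr_injective hDm
  rw [hprod, Real.dist_eq, ← integral_sub hi1 hi2, ← Real.norm_eq_abs]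
  refine (norm_integral_le_of_norm_le ((hj1.add hj2).const_mul C)
    (Eventually.of_forall key)).trans ?_
  rw [integral_const_mul]
  have := integral_add hj1 hj2
  simp only [Function.comp_def, Pi.add_apply] at this ⊢
  rw [this, hk1, hk2]
  linarith

/-- **Harris' inequality** for bounded functions of infinitely many independent variables. -/
theorem integral_mul_integral_le_of_bounded [DecidableEq ι] [Countable ι]
    (hF : Measurable F) (hG : Measurable G)
    (hFm : MonotoneUpdate F) (hGm : MonotoneUpdate G) (hFC : ∀ ω, |F ω| ≤ C)
    (hGC : ∀ ω, |G ω| ≤ C) :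
    (∫ ω, F ω ∂(Measure.infinitePi fun _ : ι => ν)) *
        ∫ ω, G ω ∂(Measure.infinitePi fun _ : ι => ν) ≤
      ∫ ω, F ω * G ω ∂(Measure.infinitePi fun _ : ι => ν) := by
  obtain ⟨s, hs⟩ := Filter.exists_seq_tendsto (atTop : Filter (Finset ι))
  obtain ⟨s, hs, hcov⟩ : ∃ s : ℕ → Finset ι, Monotone s ∧ ∀ i, ∃ n, i ∈ s n := by
    refine ⟨fun n => (Finset.range (n + 1)).sup s, fun m n h => ?_, fun i => ?_⟩
    · exact Finset.sup_mono (Finset.range_mono (by omega))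
    · obtain ⟨n, hn⟩ := (hs.eventually (eventually_ge_atTop {i})).exists
      exact ⟨n, Finset.mem_sup.2 ⟨n, by simp, hn (Finset.mem_singleton_self i)⟩⟩
  exact le_of_tendsto' (tendsto_integral_mul_resample hF hG hFC hGC s hs hcov)
    fun n => integral_mul_resample_le hF hG hFm hGm hFC hGC (s n)

/-- Truncation of a real number to `[-n, n]`. -/
noncomputable def clamp (n : ℕ) (x : ℝ) : ℝ := max (-(n : ℝ)) (min n x)

theorem abs_clamp_le (n : ℕ) (x : ℝ) : |clamp n x| ≤ n := by
  have hn : (0 : ℝ) ≤ n := n.cast_nonneg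
  exact abs_le.2 ⟨le_max_left _ _, max_le (by linarith) (min_le_left _ _)⟩

theorem abs_clamp_le_abs (n : ℕ) (x : ℝ) : |clamp n x| ≤ |x| := by
  have hn : (0 : ℝ) ≤ n := n.cast_nonneg
  rw [abs_le, clamp]
  refine ⟨?_, max_le (by linarith [abs_nonneg x]) ((min_le_right _ _).trans (le_abs_self x))⟩
  rcases le_total (n : ℝ) x with h | h
  · rw [min_eq_left h]
    exact le_max_of_le_right (by linarith [abs_nonneg x])
  · rw [min_eq_right h]
    exact le_max_of_le_right (neg_abs_le x)

theorem monotone_clamp (n : ℕ) : Monotone (clamp n) :=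
  fun _ _ h => max_le_max le_rfl (min_le_min le_rfl h)

theorem measurable_clamp (n : ℕ) : Measurable (clamp n) := (monotone_clamp n).measurable

theorem tendsto_clamp (x : ℝ) : Tendsto (fun n => clamp n x) atTop (𝓝 x) := by
  refine Tendsto.congr' ?_ tendsto_const_nhds
  obtain ⟨N, hN⟩ := exists_nat_ge |x|
  filter_upwards [eventually_ge_atTop N] with n hn
  have h : |x| ≤ n := hN.trans (Nat.cast_le.2 hn)
  rw [clamp, min_eq_right ((le_abs_self x).trans h), max_eq_right (abs_le.1 h).1]

/-- **Harris' inequality**: coordinatewise monotone functions of independent variables are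
nonnegatively correlated. -/
theorem covariance_nonneg_of_monotoneUpdate [DecidableEq ι] [Countable ι]
    (hF : Measurable F) (hG : Measurable G) (hFm : MonotoneUpdate F) (hGm : MonotoneUpdate G)
    (hFi : Integrable F (Measure.infinitePi fun _ : ι => ν))
    (hGi : Integrable G (Measure.infinitePi fun _ : ι => ν))
    (hFGi : Integrable (fun ω => F ω * G ω) (Measure.infinitePi fun _ : ι => ν)) :
    0 ≤ cov[F, G; Measure.infinitePi fun _ : ι => ν] := by
  set Q := Measure.infinitePi fun _ : ι => ν
  have hlimF : Tendsto (fun n => ∫ ω, clamp n (F ω) ∂Q) atTop (𝓝 (∫ ω, F ω ∂Q)) :=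
    tendsto_integral_of_dominated_convergence (fun ω => |F ω|)
      (fun n => ((measurable_clamp n).comp hF).aestronglyMeasurable) hFi.abs
      (fun n => Eventually.of_forall fun ω => abs_clamp_le_abs n (F ω))
      (Eventually.of_forall fun ω => tendsto_clamp (F ω))
  have hlimG : Tendsto (fun n => ∫ ω, clamp n (G ω) ∂Q) atTop (𝓝 (∫ ω, G ω ∂Q)) :=
    tendsto_integral_of_dominated_convergence (fun ω => |G ω|)
      (fun n => ((measurable_clamp n).comp hG).aestronglyMeasurable) hGi.abs
      (fun n => Eventually.of_forall fun ω => abs_clamp_le_abs n (G ω))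
      (Eventually.of_forall fun ω => tendsto_clamp (G ω))
  have hlimFG : Tendsto (fun n => ∫ ω, clamp n (F ω) * clamp n (G ω) ∂Q) atTop
      (𝓝 (∫ ω, F ω * G ω ∂Q)) :=
    tendsto_integral_of_dominated_convergence (fun ω => |F ω * G ω|)
      (fun n => (((measurable_clamp n).comp hF).mul
        ((measurable_clamp n).comp hG)).aestronglyMeasurable) hFGi.abs
      (fun n => Eventually.of_forall fun ω => by
        rw [Real.norm_eq_abs, abs_mul, abs_mul]
        exact mul_le_mul (abs_clamp_le_abs n _) (abs_clamp_le_abs n _) (abs_nonneg _)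
          (abs_nonneg _))
      (Eventually.of_forall fun ω => (tendsto_clamp (F ω)).mul (tendsto_clamp (G ω)))
  have h := le_of_tendsto_of_tendsto' (hlimF.mul hlimG) hlimFG fun n =>
    integral_mul_integral_le_of_bounded (ν := ν) ((measurable_clamp n).comp hF)
      ((measurable_clamp n).comp hG) (fun ω i x hx => monotone_clamp n (hFm ω i x hx))
      (fun ω i x hx => monotone_clamp n (hGm ω i x hx)) (fun ω => abs_clamp_le n (F ω))
      (fun ω => abs_clamp_le n (G ω))
  have e : cov[F, G; Q] = ∫ ω, F ω * G ω ∂Q - (∫ ω, F ω ∂Q) * ∫ ω, G ω ∂Q := by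
    have : ∀ ω, (F ω - Q[F]) * (G ω - Q[G]) =
        F ω * G ω - Q[G] * F ω - Q[F] * G ω + Q[F] * Q[G] := fun ω => by ring
    rw [covariance]
    simp_rw [this]
    rw [integral_add, integral_sub, integral_sub, integral_const_mul, integral_const_mul]
    · simp
      ring
    all_goals fun_prop
  rw [e]
  linarith

end Harris

/-! ### Causal linear processes driven by the coordinates of Gaussian white noise -/

section LinearProcess

/-- The law of a two-sided sequence of independent standard normal variables. -/
noncomputable def whiteNoise : Measure (ℤ → ℝ) := Measure.infinitePi fun _ : ℤ => gaussianReal 0 1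

instance : IsProbabilityMeasure whiteNoise := by unfold whiteNoise; infer_instance

theorem iIndepFun_eval : iIndepFun (fun (i : ℤ) (ω : ℤ → ℝ) => ω i) whiteNoise :=
  iIndepFun_infinitePi (X := fun _ x => x) (fun _ => measurable_id)

theorem hasLaw_eval (i : ℤ) : HasLaw (fun ω : ℤ → ℝ => ω i) (gaussianReal 0 1) whiteNoise :=
  ⟨(measurable_pi_apply i).aemeasurable, Measure.infinitePi_map_eval _ i⟩

theorem isGaussianProcess_eval :
    IsGaussianProcess (fun (i : ℤ) (ω : ℤ → ℝ) => ω i) whiteNoise where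
  hasGaussianLaw I := by
    have h : iIndepFun (fun (i : I) (ω : ℤ → ℝ) => ω i) whiteNoise :=
      iIndepFun_eval.precomp Subtype.val_injective
    exact h.hasGaussianLaw fun i => (hasLaw_eval i).hasGaussianLaw

theorem memLp_eval (i : ℤ) : MemLp (fun ω : ℤ → ℝ => ω i) 2 whiteNoise :=
  (isGaussianProcess_eval.hasGaussianLaw_eval i).memLp_two

theorem integral_eval (i : ℤ) : ∫ ω, ω i ∂whiteNoise = 0 := by
  rw [(hasLaw_eval i).integral_eq, integral_id_gaussianReal]

theorem variance_eval (i : ℤ) : Var[fun ω => ω i; whiteNoise] = 1 := by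
  rw [(hasLaw_eval i).variance_eq, variance_id_gaussianReal]
  simp

theorem covariance_eval (i j : ℤ) :
    cov[fun ω => ω i, fun ω => ω j; whiteNoise] = if i = j then 1 else 0 := by
  split_ifs with h
  · subst h
    rw [covariance_self (measurable_pi_apply i).aemeasurable, variance_eval]
  · exact (iIndepFun_eval.indepFun h).covariance_eq_zero (memLp_eval i) (memLp_eval j)

theorem eLpNorm_two_eq_of_integral_eq_zero {Ω : Type*} {mΩ : MeasurableSpace Ω} {μ : Measure Ω}
    {f : Ω → ℝ} (hf : MemLp f 2 μ) (h0 : μ[f] = 0) :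
    eLpNorm f 2 μ = ENNReal.ofReal (Real.sqrt (Var[f; μ])) := by
  rw [hf.eLpNorm_eq_integral_rpow_norm two_ne_zero ENNReal.ofNat_ne_top,
    variance_of_integral_eq_zero hf.1.aemeasurable h0]
  congr 1
  simp [Real.sqrt_eq_rpow]

/-- A finite linear combination of the noise read backwards from time `k`. -/
def block (t : ℕ → ℝ) (k : ℤ) (s : Finset ℕ) (ω : ℤ → ℝ) : ℝ := ∑ i ∈ s, t i * ω (k - i)

variable (t : ℕ → ℝ) (k : ℤ) (s : Finset ℕ)

@[fun_prop]
theorem measurable_block : Measurable (block t k s) := by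
  unfold block
  fun_prop

theorem memLp_block : MemLp (block t k s) 2 whiteNoise :=
  memLp_finsetSum s fun i _ => (memLp_eval (k - i)).const_mul (t i)

theorem integral_block : ∫ ω, block t k s ω ∂whiteNoise = 0 := by
  unfold block
  rw [integral_finsetSum]
  · simp [integral_const_mul, integral_eval]
  · exact fun i _ => ((memLp_eval (k - i)).integrable one_le_two).const_mul (t i)

theorem covariance_block_block (l : ℤ) (s' : Finset ℕ) :
    cov[block t k s, block t l s'; whiteNoise] =
      ∑ i ∈ s, ∑ j ∈ s', if k - i = l - j then t i * t j else 0 := by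
  unfold block
  rw [covariance_fun_sum_fun_sum' (fun (i : ℕ) _ => (memLp_eval (k - i)).const_mul (t i))
    (fun (i : ℕ) _ => (memLp_eval (l - i)).const_mul (t i))]
  simp_rw [covariance_const_mul_left, covariance_const_mul_right, covariance_eval]
  simp

theorem variance_block : Var[block t k s; whiteNoise] = ∑ i ∈ s, t i ^ 2 := by
  rw [← covariance_self (by fun_prop), covariance_block_block]
  refine Finset.sum_congr rfl fun i hi => ?_
  simp [hi, sq]

theorem eLpNorm_block : eLpNorm (block t k s) 2 whiteNoise =
    ENNReal.ofReal (Real.sqrt (∑ i ∈ s, t i ^ 2)) := by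
  rw [eLpNorm_two_eq_of_integral_eq_zero (memLp_block t k s) (integral_block t k s),
    variance_block]

/-- The tail `∑_{i ≥ n} t_i²`. -/
noncomputable def tailSq (n : ℕ) : ℝ := ∑' i, t (i + n) ^ 2

variable {t}

theorem sum_Ico_sq_le_tailSq (ht : Summable fun i => t i ^ 2) (m n : ℕ) :
    ∑ i ∈ Finset.Ico m n, t i ^ 2 ≤ tailSq t m := by
  rw [Finset.sum_Ico_eq_sum_range]
  have h := ((summable_nat_add_iff m).2 ht).sum_le_tsum (Finset.range (n - m))
    (fun _ _ => sq_nonneg _)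
  simpa [tailSq, add_comm] using h

theorem tendsto_tailSq : Tendsto (tailSq t) atTop (𝓝 0) := tendsto_sum_nat_add fun i => t i ^ 2

theorem antitone_tailSq (ht : Summable fun i => t i ^ 2) : Antitone (tailSq t) := by
  refine antitone_nat_of_succ_le fun n => ?_
  have h := ((summable_nat_add_iff n).2 ht).tsum_eq_zero_add
  simp only [tailSq]
  rw [h]
  have e : ∀ i, t (i + 1 + n) = t (i + (n + 1)) := fun i => by congr 1; ring
  simp only [e]
  linarith [sq_nonneg (t (0 + n))]

theorem block_range_sub (m n : ℕ) (h : m ≤ n) (ω : ℤ → ℝ) :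
    block t k (Finset.range n) ω - block t k (Finset.range m) ω =
      block t k (Finset.Ico m n) ω := by
  simp only [block]
  rw [Finset.sum_Ico_eq_sub _ h]

theorem condExp_natural_increment (n : ℕ) :
    whiteNoise[fun ω => t (n + 1) * ω (k - (n + 1 : ℕ)) |
      Filtration.natural (fun (i : ℕ) (ω : ℤ → ℝ) => ω (k - i))
        (fun i => (measurable_pi_apply (k - (i : ℤ))).stronglyMeasurable) n] =ᵐ[whiteNoise] 0 := by
  have hinj : Function.Injective fun i : ℕ => k - (i : ℤ) := fun i j h => by simpa using h
  have hi : iIndepFun (fun (i : ℕ) (ω : ℤ → ℝ) => ω (k - i)) whiteNoise :=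
    iIndepFun_eval.precomp hinj
  have h := iIndepFun.condExp_natural_ae_eq_of_lt (i := n) (j := n + 1)
    (fun i => (measurable_pi_apply (k - (i : ℤ))).stronglyMeasurable) hi n.lt_succ_self
  have h2 := condExp_smul (μ := whiteNoise) (t (n + 1)) (fun ω : ℤ → ℝ => ω (k - (n + 1 : ℕ)))
    (Filtration.natural (fun (i : ℕ) (ω : ℤ → ℝ) => ω (k - i))
        (fun i => (measurable_pi_apply (k - (i : ℤ))).stronglyMeasurable) n)
  refine h2.trans ?_
  filter_upwards [h] with ω hω
  simp only [Pi.smul_apply, Pi.zero_apply, smul_eq_mul]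
  erw [hω]
  erw [integral_eval, mul_zero]

/-- At time `n` the filtration reveals the noise at `k, ..., k - n`, hence `range (n + 1)`. The next
term is centred and independent of it. An L² bound then gives almost sure convergence of the series.
-/
theorem martingale_block :
    Martingale (fun n => block t k (Finset.range (n + 1)))
      (Filtration.natural (fun (i : ℕ) (ω : ℤ → ℝ) => ω (k - i))
        (fun i => (measurable_pi_apply (k - (i : ℤ))).stronglyMeasurable)) whiteNoise := by
  refine martingale_of_condExp_sub_eq_zero_nat (fun n => ?_)
    (fun n => (memLp_block t k _).integrable one_le_two) fun n => ?_
  · unfold block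
    refine Measurable.stronglyMeasurable ?_
    refine Finset.measurable_sum _ fun i hi => Measurable.const_mul ?_ (t i)
    have h := (Filtration.stronglyAdapted_natural (fun i : ℕ =>
      (measurable_pi_apply (X := fun _ : ℤ => ℝ) (k - (i : ℤ))).stronglyMeasurable) i).measurable
    exact h.mono (Filtration.mono _ (Nat.lt_succ_iff.1 (Finset.mem_range.1 hi))) le_rfl
  · refine Filter.EventuallyEq.trans (condExp_congr_ae ?_) (condExp_natural_increment (t := t) k n)
    refine Eventually.of_forall fun ω => ?_
    simp only [Pi.sub_apply]
    rw [block_range_sub k _ _ (by omega)]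
    simp [block]

theorem ae_exists_tendsto_block (ht : Summable fun i => t i ^ 2) :
    ∀ᵐ ω ∂whiteNoise, ∃ c, Tendsto (fun n => block t k (Finset.range n) ω) atTop (𝓝 c) := by
  have h := (martingale_block (t := t) k).submartingale.exists_ae_tendsto_of_bdd
    (R := Real.toNNReal (Real.sqrt (tailSq t 0))) fun n => by
      refine (eLpNorm_le_eLpNorm_of_exponent_le one_le_two
        (measurable_block t k _).aestronglyMeasurable).trans ?_
      rw [eLpNorm_block]
      refine ENNReal.ofReal_le_ofReal (Real.sqrt_le_sqrt ?_)
      rw [Finset.range_eq_Ico]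
      exact sum_Ico_sq_le_tailSq ht 0 _
  filter_upwards [h] with ω hω
  obtain ⟨c, hc⟩ := hω
  exact ⟨c, (tendsto_add_atTop_iff_nat 1).1 hc⟩

/-- The linear process `∑_{i ≥ 0} t_i ω_{k-i}`, with a constant value where the series diverges. -/
noncomputable def linProc (t : ℕ → ℝ) (k : ℤ) (ω : ℤ → ℝ) : ℝ :=
  limUnder atTop fun n => block t k (Finset.range n) ω

theorem ae_tendsto_linProc (ht : Summable fun i => t i ^ 2) :
    ∀ᵐ ω ∂whiteNoise,
      Tendsto (fun n => block t k (Finset.range n) ω) atTop (𝓝 (linProc t k ω)) := by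
  filter_upwards [ae_exists_tendsto_block k ht] with ω hω
  exact tendsto_nhds_limUnder hω

/-- No completion is needed, because the limit has a constant default value where it fails to exist.
The σ-algebra is arbitrary so that the lemma also yields adaptedness. -/
theorem measurable_linProc {m : MeasurableSpace (ℤ → ℝ)}
    (h : ∀ i ≤ k, Measurable[m] fun ω : ℤ → ℝ => ω i) : Measurable[m] (linProc t k) := by
  refine (StronglyMeasurable.limUnder fun n => Measurable.stronglyMeasurable ?_).measurable
  exact Finset.measurable_sum _ fun i _ => (h _ (by omega)).const_mul _

@[fun_prop]
theorem measurable_linProc_pi : Measurable (linProc t k) :=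
  measurable_linProc k fun i _ => measurable_pi_apply i

/-- Fatou's lemma along the almost sure limit: the later partial sums differ from the `n`-th by
blocks whose variance is at most the tail. -/
theorem eLpNorm_linProc_sub_block_le (ht : Summable fun i => t i ^ 2) (n : ℕ) :
    eLpNorm (fun ω => linProc t k ω - block t k (Finset.range n) ω) 2 whiteNoise ≤
      ENNReal.ofReal (Real.sqrt (tailSq t n)) := by
  refine (Lp.eLpNorm_lim_le_liminf_eLpNorm
    (f := fun m ω => block t k (Finset.range m) ω - block t k (Finset.range n) ω)
    (fun m => by fun_prop) _ ?_).trans ?_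
  · filter_upwards [ae_tendsto_linProc k ht] with ω hω
    exact hω.sub_const _
  · refine liminf_le_of_le (by isBoundedDefault) fun b hb => ?_
    obtain ⟨m, hm, hnm⟩ := (hb.and (eventually_ge_atTop n)).exists
    refine hm.trans ?_
    simp_rw [block_range_sub k n m hnm]
    rw [eLpNorm_block]
    exact ENNReal.ofReal_le_ofReal (Real.sqrt_le_sqrt (sum_Ico_sq_le_tailSq ht n m))

theorem tendsto_ofReal_sqrt_tailSq :
    Tendsto (fun n => ENNReal.ofReal (Real.sqrt (tailSq t n))) atTop (𝓝 0) := by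
  have h := ENNReal.tendsto_ofReal ((Real.continuous_sqrt.tendsto 0).comp (tendsto_tailSq (t := t)))
  simpa using h

theorem tendsto_eLpNorm_block_sub_linProc (ht : Summable fun i => t i ^ 2) :
    Tendsto (fun n => eLpNorm (fun ω => block t k (Finset.range n) ω - linProc t k ω) 2 whiteNoise)
      atTop (𝓝 0) := by
  refine tendsto_of_tendsto_of_tendsto_of_le_of_le tendsto_const_nhds
    (tendsto_ofReal_sqrt_tailSq (t := t)) (fun _ => bot_le) fun n => ?_
  have := eLpNorm_sub_comm (fun ω => block t k (Finset.range n) ω) (linProc t k) 2 whiteNoise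
  exact (this.le).trans (eLpNorm_linProc_sub_block_le k ht n)

theorem memLp_linProc (ht : Summable fun i => t i ^ 2) : MemLp (linProc t k) 2 whiteNoise := by
  refine ⟨by fun_prop, ?_⟩
  have h := eLpNorm_linProc_sub_block_le k ht 0
  simp only [block, Finset.range_zero, Finset.sum_empty, sub_zero] at h
  exact h.trans_lt ENNReal.ofReal_lt_top

theorem isCausalLinearProcess_linProc (ht : Summable fun i => t i ^ 2) :
    IsCausalLinearProcess whiteNoise t (fun i ω => ω i) (linProc t) where
  summable_sq := ht
  ae_tendsto k := ae_tendsto_linProc k ht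
  tendsto_eLpNorm k := tendsto_eLpNorm_block_sub_linProc k ht

theorem isStrictlyStationary_linProc : IsStrictlyStationary whiteNoise (linProc t) := by
  intro h
  have hs : MeasurePreserving (fun (ω : ℤ → ℝ) i => ω (i + h)) whiteNoise whiteNoise :=
    measurePreserving_precomp (add_left_injective h)
  have he : (fun ω k => linProc t (k + h) ω) =
      (fun ω k => linProc t k ω) ∘ fun (ω : ℤ → ℝ) i => ω (i + h) := by
    funext ω k
    simp only [Function.comp, linProc, block]
    congr! 5 with n i
    ring_nf
  have hm : Measurable fun ω k => linProc t k ω := by fun_prop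
  refine ⟨?_, hm.aemeasurable, ?_⟩
  · rw [he]
    exact (hm.comp hs.measurable).aemeasurable
  · rw [he, ← Measure.map_map hm hs.measurable, hs.map_eq]

/-- One changed coordinate shifts all late partial sums by the same `δ ≥ 0`, so convergence is
unaffected, and on divergence both values are the same default. Raising infinitely many coordinates
at once could destroy convergence, which is why monotonicity is only asked for single updates. -/
theorem monotoneUpdate_linProc (ht : ∀ i, 0 ≤ t i) : MonotoneUpdate (linProc t k) := by
  intro ω j x hx
  set δ : ℝ := if j ≤ k then t (k - j).toNat * (x - ω j) else 0 with hδ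
  have hδ0 : 0 ≤ δ := by
    rw [hδ]
    split_ifs
    · exact mul_nonneg (ht _) (sub_nonneg.2 hx)
    · exact le_rfl
  have hev : (fun n => block t k (Finset.range n) (Function.update ω j x)) =ᶠ[atTop]
      fun n => block t k (Finset.range n) ω + δ := by
    filter_upwards [eventually_gt_atTop (k - j).toNat] with n hn
    have : block t k (Finset.range n) (Function.update ω j x) - block t k (Finset.range n) ω =
        δ := by
      simp only [block]
      rw [← Finset.sum_sub_distrib, hδ]
      split_ifs with hjk
      · rw [Finset.sum_eq_single (k - j).toNat]
        · have : k - ((k - j).toNat : ℤ) = j := by omega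
          rw [this, Function.update_self]
          ring
        · intro i _ hi
          rw [Function.update_of_ne (by omega)]
          ring
        · intro h
          exact absurd (Finset.mem_range.2 hn) h
      · refine Finset.sum_eq_zero fun i _ => ?_
        rw [Function.update_of_ne (by omega)]
        ring
    linarith
  by_cases hc : ∃ c, Tendsto (fun n => block t k (Finset.range n) ω) atTop (𝓝 c)
  · have h1 := (tendsto_nhds_limUnder hc).add_const δ
    have h2 := (h1.congr' hev.symm).limUnder_eq
    simp only [linProc]
    rw [h2]
    linarith
  · have hc' : ¬ ∃ c, Tendsto (fun n => block t k (Finset.range n) (Function.update ω j x))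
        atTop (𝓝 c) := by
      rintro ⟨c, h⟩
      refine hc ⟨c - δ, ((h.congr' hev).sub_const δ).congr fun n => ?_⟩
      ring
    simp only [linProc]
    rw [limUnder_of_not_tendsto hc, limUnder_of_not_tendsto hc']

theorem isPositivelyAssociated_linProc (ht : ∀ i, 0 ≤ t i) :
    IsPositivelyAssociated whiteNoise (linProc t) := by
  intro I f g hf hg hfm hgm hfi hgi hfgi
  refine covariance_nonneg_of_monotoneUpdate (by fun_prop) (by fun_prop) ?_ ?_ hfi hgi hfgi
  · exact fun ω i x hx => hf fun k => monotoneUpdate_linProc k ht ω i x hx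
  · exact fun ω i x hx => hg fun k => monotoneUpdate_linProc k ht ω i x hx

end LinearProcess

/-! ### Second order structure and Gaussianity of the linear process -/

section SecondOrder

variable {Ω : Type*} {mΩ : MeasurableSpace Ω} {μ : Measure Ω}

theorem tendsto_integral_mul_of_tendsto_eLpNorm {f g : ℕ → Ω → ℝ} {f' g' : Ω → ℝ}
    (hf : ∀ n, MemLp (f n) 2 μ) (hg : ∀ n, MemLp (g n) 2 μ) (hf' : MemLp f' 2 μ)
    (hg' : MemLp g' 2 μ) (hff : Tendsto (fun n => eLpNorm (f n - f') 2 μ) atTop (𝓝 0))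
    (hgg : Tendsto (fun n => eLpNorm (g n - g') 2 μ) atTop (𝓝 0)) :
    Tendsto (fun n => ∫ ω, f n ω * g n ω ∂μ) atTop (𝓝 (∫ ω, f' ω * g' ω ∂μ)) := by
  have h1 := (Lp.tendsto_Lp_iff_tendsto_eLpNorm'' f hf f' hf').2 hff
  have h2 := (Lp.tendsto_Lp_iff_tendsto_eLpNorm'' g hg g' hg').2 hgg
  have e : ∀ {u v : Ω → ℝ} (hu : MemLp u 2 μ) (hv : MemLp v 2 μ),
      inner ℝ (hu.toLp u) (hv.toLp v) = ∫ ω, u ω * v ω ∂μ := by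
    intro u v hu hv
    rw [L2.inner_def]
    refine integral_congr_ae ?_
    filter_upwards [hu.coeFn_toLp, hv.coeFn_toLp] with ω h3 h4
    simp [h3, h4, mul_comm]
  have h3 := h1.inner (𝕜 := ℝ) h2
  simp only [e] at h3
  exact h3

variable [IsProbabilityMeasure μ]

theorem tendsto_integral_of_tendsto_eLpNorm {f : ℕ → Ω → ℝ} {f' : Ω → ℝ}
    (hf : ∀ n, MemLp (f n) 2 μ) (hf' : MemLp f' 2 μ)
    (hff : Tendsto (fun n => eLpNorm (f n - f') 2 μ) atTop (𝓝 0)) :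
    Tendsto (fun n => ∫ ω, f n ω ∂μ) atTop (𝓝 (∫ ω, f' ω ∂μ)) := by
  simpa using tendsto_integral_mul_of_tendsto_eLpNorm (g := fun _ _ => 1) (g' := fun _ => 1)
    hf (fun _ => memLp_const 1) hf' (memLp_const 1) hff (by simp)

theorem tendsto_covariance_of_tendsto_eLpNorm {f g : ℕ → Ω → ℝ} {f' g' : Ω → ℝ}
    (hf : ∀ n, MemLp (f n) 2 μ) (hg : ∀ n, MemLp (g n) 2 μ) (hf' : MemLp f' 2 μ)
    (hg' : MemLp g' 2 μ) (hff : Tendsto (fun n => eLpNorm (f n - f') 2 μ) atTop (𝓝 0))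
    (hgg : Tendsto (fun n => eLpNorm (g n - g') 2 μ) atTop (𝓝 0)) :
    Tendsto (fun n => cov[f n, g n; μ]) atTop (𝓝 cov[f', g'; μ]) := by
  simp only [fun n => covariance_eq_sub (hf n) (hg n), covariance_eq_sub hf' hg']
  exact (tendsto_integral_mul_of_tendsto_eLpNorm hf hg hf' hg' hff hgg).sub
    ((tendsto_integral_of_tendsto_eLpNorm hf hf' hff).mul
      (tendsto_integral_of_tendsto_eLpNorm hg hg' hgg))

/-- Limits, almost surely and in `L²`, of Gaussian vectors are Gaussian. -/
theorem hasGaussianLaw_of_tendsto {E : Type*} [NormedAddCommGroup E] [NormedSpace ℝ E]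
    [MeasurableSpace E] [BorelSpace E] [SecondCountableTopology E] [CompleteSpace E]
    {Z : ℕ → Ω → E} {Z' : Ω → E}
    (hZ : ∀ n, HasGaussianLaw (Z n) μ) (hZ' : AEMeasurable Z' μ)
    (hL' : ∀ L : StrongDual ℝ E, MemLp (L ∘ Z') 2 μ)
    (hae : ∀ᵐ ω ∂μ, Tendsto (fun n => Z n ω) atTop (𝓝 (Z' ω)))
    (hL : ∀ L : StrongDual ℝ E,
      Tendsto (fun n => eLpNorm (L ∘ Z n - L ∘ Z') 2 μ) atTop (𝓝 0)) :
    HasGaussianLaw Z' μ := by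
  rw [hasGaussianLaw_iff_charFunDual_map_eq hZ']
  intro L
  have hm : ∀ n, MemLp (L ∘ Z n) 2 μ := fun n => ((hZ n).map L).memLp_two
  have h1 : Tendsto (fun n => charFunDual (μ.map (Z n)) L) atTop
      (𝓝 (charFunDual (μ.map Z') L)) := by
    simp only [charFunDual_apply]
    have e : ∀ {u : Ω → E}, AEMeasurable u μ →
        ∫ v, Complex.exp (L v * Complex.I) ∂(μ.map u) =
          ∫ ω, Complex.exp (L (u ω) * Complex.I) ∂μ := fun hu =>
      integral_map hu (by fun_prop)
    simp only [e hZ', fun n => e (hZ n).aemeasurable]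
    refine tendsto_integral_of_dominated_convergence (fun _ => 1) (fun n => ?_)
      (integrable_const 1) (fun n => Eventually.of_forall fun ω => ?_) ?_
    · have := (hZ n).aemeasurable
      exact AEMeasurable.aestronglyMeasurable (by fun_prop)
    · rw [Complex.norm_exp_ofReal_mul_I]
    · filter_upwards [hae] with ω hω
      have hc : Continuous fun x : E => Complex.exp (L x * Complex.I) := by fun_prop
      exact (hc.tendsto _).comp hω
  have h2 : Tendsto (fun n => Complex.exp ((μ[L ∘ Z n] : ℝ) * Complex.I - Var[L ∘ Z n; μ] / 2))
      atTop (𝓝 (Complex.exp ((μ[L ∘ Z'] : ℝ) * Complex.I - Var[L ∘ Z'; μ] / 2))) := by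
    have ha := tendsto_integral_of_tendsto_eLpNorm hm (hL' L) (hL L)
    have hb := tendsto_covariance_of_tendsto_eLpNorm hm hm (hL' L) (hL' L) (hL L) (hL L)
    simp only [covariance_self (hL' L).1.aemeasurable,
      fun n => covariance_self (hm n).1.aemeasurable] at hb
    have hc : Continuous fun p : ℝ × ℝ =>
      Complex.exp ((p.1 : ℂ) * Complex.I - (p.2 : ℂ) / 2) := by fun_prop
    exact (hc.tendsto _).comp (ha.prodMk_nhds hb)
  -- The characteristic functions converge by dominated convergence, and their Gaussian expressions
  -- converge because means and variances do. The two limits must agree.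
  refine tendsto_nhds_unique h1 (h2.congr fun n => ?_)
  exact ((hZ n).charFunDual_map_eq L).symm

/-- This is the real part of the characteristic function. Since cosine is bounded and continuous, it
allows variances to be read off from weak limits. -/
theorem integral_cos_of_hasGaussianLaw {Z : Ω → ℝ} (hZ : HasGaussianLaw Z μ) (h0 : μ[Z] = 0) :
    ∫ ω, Real.cos (Z ω) ∂μ = Real.exp (-(Var[Z; μ] / 2)) := by
  have h := hZ.charFunDual_map_eq (ContinuousLinearMap.id ℝ ℝ)
  rw [charFunDual_apply, integral_map hZ.aemeasurable (by fun_prop)] at h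
  simp only [ContinuousLinearMap.coe_id', Function.id_comp, h0, id_eq, Complex.ofReal_zero,
    zero_mul, zero_sub] at h
  have hi : Integrable (fun ω => Complex.exp (Z ω * Complex.I)) μ := by
    have := hZ.aemeasurable
    refine Integrable.of_bound (AEMeasurable.aestronglyMeasurable (by fun_prop)) 1
      (Eventually.of_forall fun ω => ?_)
    rw [Complex.norm_exp_ofReal_mul_I]
  have h2 := congrArg Complex.re h
  have h3 := integral_re (𝕜 := ℂ) hi
  simp only [RCLike.re_to_complex] at h3
  rw [← h3] at h2
  simp only [Complex.exp_ofReal_mul_I_re] at h2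
  rw [h2, ← Complex.exp_ofReal_re]
  congr 2
  push_cast
  ring

end SecondOrder

/-! ### Gaussianity of the linear process and the lower bound for the variance of its partial sums
-/

section LinearProcess

variable {t : ℕ → ℝ}

theorem isGaussianProcess_block (s : Finset ℕ) :
    IsGaussianProcess (fun k => block t k s) whiteNoise := by
  refine isGaussianProcess_eval.of_isGaussianProcess fun k => ?_
  refine ⟨s.image fun i : ℕ => k - (i : ℤ), ∑ i : s, t i • ContinuousLinearMap.proj
    (R := ℝ) (φ := fun _ => ℝ) ⟨k - (i : ℕ), Finset.mem_image_of_mem _ i.2⟩, fun ω => ?_⟩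
  simp only [block, FunLike.coe_sum, Finset.sum_apply,
    smul_apply, ContinuousLinearMap.proj_apply, Finset.restrict,
    smul_eq_mul]
  exact (Finset.sum_coe_sort s fun i : ℕ => t i * ω (k - (i : ℤ))).symm

theorem isGaussianProcess_linProc (ht : Summable fun i => t i ^ 2) :
    IsGaussianProcess (linProc t) whiteNoise where
  hasGaussianLaw I := by
    have hsum : ∀ (L : StrongDual ℝ (I → ℝ)) (x : I → ℝ),
        L x = ∑ k, L (Pi.single k 1) * x k := by
      intro L x
      conv_lhs => rw [← LinearMap.sum_single_apply (φ := fun _ : I => ℝ) x]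
      rw [map_sum]
      refine Finset.sum_congr rfl fun k _ => ?_
      have : (Pi.single k (x k) : I → ℝ) = x k • Pi.single k (1 : ℝ) := by
        rw [← Pi.single_smul]
        simp
      rw [this, map_smul, smul_eq_mul, mul_comm]
    have hmeas : Measurable fun ω => I.restrict (linProc t · ω) := by
      refine measurable_pi_lambda _ fun k => ?_
      exact measurable_linProc_pi (t := t) k
    refine hasGaussianLaw_of_tendsto
      (Z := fun n ω => I.restrict (fun k => block t k (Finset.range n) ω))
      (fun n => (isGaussianProcess_block (Finset.range n)).hasGaussianLaw I)
      hmeas.aemeasurable (fun L => ?_) ?_ fun L => ?_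
    · have e : L ∘ (fun ω => I.restrict (linProc t · ω)) =
          fun ω => ∑ k : I, L (Pi.single k 1) * linProc t k ω := by
        funext ω
        exact hsum L _
      rw [e]
      exact memLp_finsetSum _ fun k _ => (memLp_linProc (k : ℤ) ht).const_mul _
    · have := ae_all_iff.2 fun k : I => ae_tendsto_linProc (k : ℤ) ht
      filter_upwards [this] with ω hω
      exact tendsto_pi_nhds.2 hω
    · have hb : ∀ n, eLpNorm (L ∘ (fun ω => I.restrict (fun k => block t k (Finset.range n) ω)) -
          L ∘ (fun ω => I.restrict (linProc t · ω))) 2 whiteNoise ≤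
          ∑ k : I, ‖L (Pi.single k 1)‖ₑ *
            eLpNorm (fun ω => block t k (Finset.range n) ω - linProc t k ω) 2 whiteNoise := by
        intro n
        have e : L ∘ (fun ω => I.restrict (fun k => block t k (Finset.range n) ω)) -
            L ∘ (fun ω => I.restrict (linProc t · ω)) =
            ∑ k : I, L (Pi.single k 1) •
              (fun ω => block t k (Finset.range n) ω - linProc t k ω) := by
          funext ω
          simp only [Pi.sub_apply, Function.comp, Finset.sum_apply, Pi.smul_apply, smul_eq_mul]
          rw [hsum, hsum, ← Finset.sum_sub_distrib]
          exact Finset.sum_congr rfl fun k _ => (mul_sub _ _ _).symm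
        rw [e]
        refine (eLpNorm_sum_le (fun k _ => ?_) one_le_two).trans (Finset.sum_le_sum fun k _ => ?_)
        · exact Measurable.aestronglyMeasurable (by fun_prop)
        · exact (eLpNorm_const_smul _ _ _ _).le
      refine tendsto_of_tendsto_of_tendsto_of_le_of_le tendsto_const_nhds ?_
        (fun _ => bot_le) hb
      have h0 : (0 : ℝ≥0∞) = ∑ k : I, ‖L (Pi.single k 1)‖ₑ * 0 := by simp
      rw [h0]
      refine tendsto_finsetSum _ fun k _ => ?_
      exact ENNReal.Tendsto.const_mul (tendsto_eLpNorm_block_sub_linProc (k : ℤ) ht)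
        (Or.inr enorm_ne_top)

theorem integral_linProc (ht : Summable fun i => t i ^ 2) (k : ℤ) :
    ∫ ω, linProc t k ω ∂whiteNoise = 0 := by
  have h := tendsto_integral_of_tendsto_eLpNorm (fun n => memLp_block t k (Finset.range n))
    (memLp_linProc k ht) (tendsto_eLpNorm_block_sub_linProc k ht)
  simp only [integral_block] at h
  exact (tendsto_nhds_unique tendsto_const_nhds h).symm

theorem covariance_linProc_eval (ht : Summable fun i => t i ^ 2) (k : ℤ) (i : ℕ) :
    cov[linProc t k, fun ω => ω (k - i); whiteNoise] = t i := by
  have h := tendsto_covariance_of_tendsto_eLpNorm (fun n => memLp_block t k (Finset.range n))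
    (fun _ => memLp_eval (k - i)) (memLp_linProc k ht) (memLp_eval (k - i))
    (tendsto_eLpNorm_block_sub_linProc k ht) (by simp)
  refine tendsto_nhds_unique h (tendsto_const_nhds.congr' ?_)
  filter_upwards [eventually_gt_atTop i] with n hn
  unfold block
  rw [covariance_fun_sum_left' (fun (j : ℕ) _ => (memLp_eval (k - j)).const_mul (t j))
    (memLp_eval (k - i))]
  simp_rw [covariance_const_mul_left, covariance_eval]
  simp [hn]

theorem hasGaussianLaw_partialSum (ht : Summable fun i => t i ^ 2) (n : ℕ) :
    HasGaussianLaw (partialSum (linProc t) n) whiteNoise :=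
  ((isGaussianProcess_linProc ht).comp_right (fun k : ℕ => (k : ℤ))).hasGaussianLaw_fun_sum
    (I := Finset.Icc 1 n)

theorem memLp_partialSum (ht : Summable fun i => t i ^ 2) (n : ℕ) :
    MemLp (partialSum (linProc t) n) 2 whiteNoise :=
  (hasGaussianLaw_partialSum ht n).memLp_two

theorem integral_partialSum (ht : Summable fun i => t i ^ 2) (n : ℕ) :
    ∫ ω, partialSum (linProc t) n ω ∂whiteNoise = 0 := by
  unfold partialSum
  rw [integral_finsetSum _ fun (k : ℕ) _ => (memLp_linProc (k : ℤ) ht).integrable one_le_two]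
  exact Finset.sum_eq_zero fun k _ => integral_linProc ht k

/-- Cauchy–Schwarz against `V`, the sum of the `n` innovations at times `0, -1, ..., -(n - 1)`. Its
variance is `n`, and its covariance with `S_n` is a sum of `n²` coefficients with index at most `2 *
n`. -/
theorem le_variance_partialSum (ht : Summable fun i => t i ^ 2) (h0 : ∀ i, 0 ≤ t i)
    (hanti : Antitone t) (n : ℕ) :
    (n : ℝ) ^ 3 * t (2 * n) ^ 2 ≤ Var[partialSum (linProc t) n; whiteNoise] := by
  set V : (ℤ → ℝ) → ℝ := fun ω => ∑ j ∈ Finset.range n, ω (-(j : ℤ)) with hV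
  have hVm : MemLp V 2 whiteNoise := memLp_finsetSum _ fun j _ => memLp_eval (-(j : ℤ))
  have hVar : Var[V; whiteNoise] = n := by
    rw [← covariance_self hVm.1.aemeasurable, hV,
      covariance_fun_sum_fun_sum' (fun (j : ℕ) _ => memLp_eval (-(j : ℤ)))
        (fun (j : ℕ) _ => memLp_eval (-(j : ℤ)))]
    simp_rw [covariance_eval]
    have : ∀ i ∈ Finset.range n,
        (∑ j ∈ Finset.range n, if -(i : ℤ) = -(j : ℤ) then (1 : ℝ) else 0) = 1 := by
      intro i hi
      rw [Finset.sum_eq_single_of_mem i hi]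
      · simp
      · intro j _ hj
        rw [if_neg]
        omega
    rw [Finset.sum_congr rfl this]
    simp
  have hcov : (n : ℝ) ^ 2 * t (2 * n) ≤ cov[partialSum (linProc t) n, V; whiteNoise] := by
    have e : cov[partialSum (linProc t) n, V; whiteNoise] =
        ∑ k ∈ Finset.Icc 1 n, ∑ j ∈ Finset.range n, t (k + j) := by
      unfold partialSum
      rw [hV, covariance_fun_sum_fun_sum' (fun (k : ℕ) _ => memLp_linProc (k : ℤ) ht)
        (fun (j : ℕ) _ => memLp_eval (-(j : ℤ)))]
      refine Finset.sum_congr rfl fun k _ => Finset.sum_congr rfl fun j _ => ?_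
      rw [← covariance_linProc_eval ht k (k + j)]
      congr! 3
      push_cast
      ring
    rw [e]
    have : ∀ k ∈ Finset.Icc 1 n, (n : ℝ) * t (2 * n) ≤ ∑ j ∈ Finset.range n, t (k + j) := by
      intro k hk
      have := Finset.card_nsmul_le_sum (Finset.range n) (fun j => t (k + j)) (t (2 * n))
        fun j hj => hanti (by
          have := (Finset.mem_Icc.1 hk).2
          have := Finset.mem_range.1 hj
          omega)
      simpa using this
    have h2 := Finset.card_nsmul_le_sum _ _ _ this
    simp only [Nat.card_Icc, add_tsub_cancel_right, nsmul_eq_mul] at h2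
    calc (n : ℝ) ^ 2 * t (2 * n) = n * (n * t (2 * n)) := by ring
      _ ≤ _ := h2
  -- With `c` the lower bound for `Cov(S_n, V) / Var V`, nonnegativity of `Var(S_n - c V)` gives
  -- `Var S_n ≥ 2 c Cov(S_n, V) - c² n ≥ c² n`.
  set c := (n : ℝ) * t (2 * n)
  have hc : 0 ≤ c := mul_nonneg n.cast_nonneg (h0 _)
  have hnn := variance_nonneg (partialSum (linProc t) n - fun ω => c * V ω) whiteNoise
  rw [variance_sub (memLp_partialSum ht n) (hVm.const_mul c), covariance_const_mul_right,
    variance_const_mul, hVar] at hnn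
  have h3 := mul_le_mul_of_nonneg_left hcov hc
  have e1 : c * ((n : ℝ) ^ 2 * t (2 * n)) = (n : ℝ) ^ 3 * t (2 * n) ^ 2 := by
    simp only [c]
    ring
  have e2 : c ^ 2 * n = (n : ℝ) ^ 3 * t (2 * n) ^ 2 := by
    simp only [c]
    ring
  rw [e1] at h3
  rw [e2] at hnn
  linarith

end LinearProcess

/-! ### Growth of the variances -/

section Growth

/-- A positive sequence growing at least like `n² / ln⁴ n` cannot satisfy `c_{2n} / c_n → 2`. -/
theorem not_tendsto_ratio_two {c : ℕ → ℝ} {A : ℝ} (hA : 0 < A) (hpos : ∀ n, 1 ≤ n → 0 < c n)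
    (hlow : ∀ n : ℕ, 3 ≤ n → A * (n : ℝ) ^ 2 / Real.log n ^ 4 ≤ c n) :
    ¬ Tendsto (fun n => c (2 * n) / c n) atTop (𝓝 2) := by
  intro h
  -- Any number strictly between 2 and 4 could replace 3: doubling multiplies `c` by less than 3,
  -- whereas `n²` gains a factor 4.
  obtain ⟨N, hN⟩ := eventually_atTop.1
    ((h.eventually (gt_mem_nhds (show (2 : ℝ) < 3 by norm_num))).and (eventually_ge_atTop 3))
  have hN3 : 3 ≤ N := (hN N le_rfl).2
  have hup : ∀ r : ℕ, c (2 ^ r * N) ≤ 3 ^ r * c N := by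
    intro r
    induction r with
    | zero => simp
    | succ r ih =>
      have hle : N ≤ 2 ^ r * N := Nat.le_mul_of_pos_left N (by positivity)
      have h1 := (hN _ hle).1
      rw [div_lt_iff₀ (hpos _ (by omega))] at h1
      have e : 2 ^ (r + 1) * N = 2 * (2 ^ r * N) := by ring
      rw [e, pow_succ]
      linarith
  have hN0 : (0 : ℝ) < N := by exact_mod_cast (by omega : 0 < N)
  have hlog : ∀ r : ℕ, Real.log ((2 ^ r * N : ℕ) : ℝ) ≤ (r + 1) * N := by
    intro r
    push_cast
    rw [Real.log_mul (by positivity) (by positivity), Real.log_pow]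
    have h1 : Real.log 2 ≤ 1 := by linarith [Real.log_two_lt_d9]
    have h2 := Real.log_le_sub_one_of_pos hN0
    have h3 : (1 : ℝ) ≤ N := by exact_mod_cast (by omega : 1 ≤ N)
    have h4 : (r : ℝ) * Real.log 2 ≤ r * N :=
      mul_le_mul_of_nonneg_left (h1.trans h3) r.cast_nonneg
    linarith
  have hkey : ∀ r : ℕ, (4 / 3 : ℝ) ^ r * (A * (N : ℝ) ^ 2) ≤ c N * ((r + 1) * N) ^ 4 := by
    intro r
    have hM : 3 ≤ 2 ^ r * N := hN3.trans (Nat.le_mul_of_pos_left N (by positivity))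
    have h1 := (hlow _ hM).trans (hup r)
    have hl0 : 0 < Real.log ((2 ^ r * N : ℕ) : ℝ) :=
      Real.log_pos (by exact_mod_cast (by omega : 1 < 2 ^ r * N))
    rw [div_le_iff₀ (by positivity)] at h1
    have h2 : Real.log ((2 ^ r * N : ℕ) : ℝ) ^ 4 ≤ ((r + 1) * N) ^ 4 :=
      pow_le_pow_left₀ hl0.le (hlog r) 4
    have hcN := hpos N (by omega)
    have h3 := h1.trans (mul_le_mul_of_nonneg_left h2 (by positivity : 0 ≤ 3 ^ r * c N))
    have e1 : A * (((2 ^ r * N : ℕ) : ℝ)) ^ 2 = 3 ^ r * ((4 / 3 : ℝ) ^ r * (A * (N : ℝ) ^ 2)) := by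
      have : (4 : ℝ) ^ r = 3 ^ r * (4 / 3) ^ r := by
        rw [← mul_pow]
        norm_num
      push_cast
      rw [mul_pow, ← pow_mul, mul_comm r 2, pow_mul]
      norm_num
      rw [this]
      ring
    rw [e1, mul_assoc] at h3
    exact le_of_mul_le_mul_left h3 (by positivity)
  have hlim : Tendsto (fun r : ℕ => c N * (N : ℝ) ^ 4 * (4 / 3) *
      (((r + 1 : ℕ) : ℝ) ^ 4 / (4 / 3 : ℝ) ^ (r + 1))) atTop (𝓝 (c N * (N : ℝ) ^ 4 * (4 / 3) * 0)) :=
    ((tendsto_add_atTop_iff_nat 1).2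
      (tendsto_pow_const_div_const_pow_of_one_lt 4 (by norm_num : (1 : ℝ) < 4 / 3))).const_mul _
  have hle : A * (N : ℝ) ^ 2 ≤ c N * (N : ℝ) ^ 4 * (4 / 3) * 0 := by
    refine ge_of_tendsto' hlim fun r => ?_
    have h1 := hkey r
    have hp : (0 : ℝ) < (4 / 3) ^ r := by positivity
    rw [mul_comm, ← le_div_iff₀ hp] at h1
    refine h1.trans (le_of_eq ?_)
    have e : (4 / 3 : ℝ) ^ (r + 1) = (4 / 3) ^ r * (4 / 3) := pow_succ _ _
    rw [e]
    push_cast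
    field_simp
  have : 0 < A * (N : ℝ) ^ 2 := by positivity
  linarith

/-- The coefficients `(i + 1)^{-1/2} (1 + ln (i + 1))⁻¹`. -/
noncomputable def coeff (i : ℕ) : ℝ :=
  (Real.sqrt ((i : ℝ) + 1) * (1 + Real.log ((i : ℝ) + 1)))⁻¹

theorem coeff_pos (i : ℕ) : 0 < coeff i := by
  have h : 0 ≤ Real.log ((i : ℝ) + 1) := Real.log_nonneg (by linarith [i.cast_nonneg (α := ℝ)])
  unfold coeff
  positivity

theorem coeff_sq (i : ℕ) :
    coeff i ^ 2 = (((i : ℝ) + 1) * (1 + Real.log ((i : ℝ) + 1)) ^ 2)⁻¹ := by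
  rw [coeff, inv_pow, mul_pow, Real.sq_sqrt (by positivity)]

theorem antitone_coeff : Antitone coeff := by
  intro i j h
  have hij : (i : ℝ) ≤ j := Nat.cast_le.2 h
  have hi : (0 : ℝ) ≤ i := i.cast_nonneg
  have h1 : Real.sqrt ((i : ℝ) + 1) ≤ Real.sqrt ((j : ℝ) + 1) := Real.sqrt_le_sqrt (by linarith)
  have h2 : Real.log ((i : ℝ) + 1) ≤ Real.log ((j : ℝ) + 1) :=
    Real.log_le_log (by linarith) (by linarith)
  have h0 : 0 ≤ Real.log ((i : ℝ) + 1) := Real.log_nonneg (by linarith)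
  exact inv_anti₀ (by positivity) (mul_le_mul h1 (by linarith) (by linarith) (by positivity))

/-- Cauchy condensation turns the series into the sum of `(1 + k ln 2)⁻²`, which is dominated by a
multiple of the sum of `(k + 1)⁻²`. -/
theorem summable_coeff_sq : Summable fun i => coeff i ^ 2 := by
  have h : Summable fun n : ℕ => ((n : ℝ) * (1 + Real.log n) ^ 2)⁻¹ := by
    rw [← summable_condensed_iff_of_nonneg]
    · have hl : 0 < Real.log 2 := Real.log_pos one_lt_two
      have hs : Summable fun k : ℕ => ((Real.log 2) ^ 2)⁻¹ * (((k + 1 : ℕ) : ℝ) ^ 2)⁻¹ :=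
        ((summable_nat_add_iff 1).2 (Real.summable_nat_pow_inv.2 one_lt_two)).mul_left _
      refine hs.of_nonneg_of_le (fun k => by positivity) fun k => ?_
      push_cast
      rw [Real.log_pow, mul_inv, ← mul_assoc, mul_inv_cancel₀ (by positivity), one_mul,
        ← mul_inv, ← mul_pow]
      refine inv_anti₀ (by positivity) (pow_le_pow_left₀ (by positivity) ?_ 2)
      have h1 : Real.log 2 ≤ 1 := by linarith [Real.log_two_lt_d9]
      nlinarith
    · exact fun n => by positivity
    · intro m n hm hmn
      have h1 : (1 : ℝ) ≤ m := by exact_mod_cast hm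
      have h2 : (m : ℝ) ≤ n := Nat.cast_le.2 hmn
      have h3 : 0 ≤ Real.log m := Real.log_nonneg h1
      have h4 : Real.log m ≤ Real.log n := Real.log_le_log (by linarith) h2
      exact inv_anti₀ (by positivity)
        (mul_le_mul h2 (pow_le_pow_left₀ (by linarith) (by linarith) 2) (by positivity)
          (by linarith))
  have h' := (summable_nat_add_iff 1).2 h
  refine h'.congr fun i => ?_
  rw [coeff_sq]
  push_cast
  rfl

/-- Here 48 is `3 * 16`, from `2n + 1 ≤ 3n` and `1 + ln (2n + 1) ≤ 4 ln n`. The condition `3 ≤ n`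
ensures `ln n ≥ 1`, so that the true power `ln²` may be weakened to `ln⁴`. -/
theorem le_cube_mul_coeff_sq {n : ℕ} (hn : 3 ≤ n) :
    1 / 48 * (n : ℝ) ^ 2 / Real.log n ^ 4 ≤ (n : ℝ) ^ 3 * coeff (2 * n) ^ 2 := by
  have hn3 : (3 : ℝ) ≤ n := by exact_mod_cast hn
  have hn0 : (0 : ℝ) < n := by linarith
  have hL : 1 ≤ Real.log n := by
    rw [Real.le_log_iff_exp_le hn0]
    linarith [Real.exp_one_lt_d9]
  have h1 : Real.log (((2 * n : ℕ) : ℝ) + 1) ≤ 2 + Real.log n := by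
    have ha : Real.log (((2 * n : ℕ) : ℝ) + 1) ≤ Real.log (3 * n) := by
      refine Real.log_le_log (by positivity) ?_
      push_cast
      linarith
    rw [Real.log_mul (by norm_num) hn0.ne'] at ha
    have := Real.log_le_sub_one_of_pos (show (0 : ℝ) < 3 by norm_num)
    linarith
  have h0 : 0 ≤ Real.log (((2 * n : ℕ) : ℝ) + 1) := Real.log_nonneg (by
    linarith [(2 * n).cast_nonneg (α := ℝ)])
  rw [coeff_sq]
  have h2 : (1 + Real.log (((2 * n : ℕ) : ℝ) + 1)) ^ 2 ≤ 16 * Real.log n ^ 4 := by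
    have ha : (1 + Real.log (((2 * n : ℕ) : ℝ) + 1)) ^ 2 ≤ (4 * Real.log n) ^ 2 :=
      pow_le_pow_left₀ (by linarith) (by linarith) 2
    have hb : Real.log n ^ 2 ≤ Real.log n ^ 4 := pow_le_pow_right₀ hL (by norm_num)
    calc _ ≤ _ := ha
      _ = 16 * Real.log n ^ 2 := by ring
      _ ≤ _ := by linarith
  have h3 : (((2 * n : ℕ) : ℝ) + 1) * (1 + Real.log (((2 * n : ℕ) : ℝ) + 1)) ^ 2 ≤
      (3 * n) * (16 * Real.log n ^ 4) := by
    refine mul_le_mul ?_ h2 (by positivity) (by positivity)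
    push_cast
    linarith
  have h4 := inv_anti₀ (by positivity) h3
  have h5 := mul_le_mul_of_nonneg_left h4 (by positivity : 0 ≤ (n : ℝ) ^ 3)
  refine le_trans (le_of_eq ?_) h5
  field_simp
  norm_num

end Growth

/-! ### Consequences for the partial sums -/

section PartialSums

theorem variance_partialSum_pos {n : ℕ} (hn : 1 ≤ n) :
    0 < Var[partialSum (linProc coeff) n; whiteNoise] := by
  refine lt_of_lt_of_le ?_ (le_variance_partialSum summable_coeff_sq
    (fun i => (coeff_pos i).le) antitone_coeff n)
  have := coeff_pos (2 * n)
  have : (0 : ℝ) < n := by exact_mod_cast hn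
  positivity

theorem le_variance_partialSum_coeff {n : ℕ} (hn : 3 ≤ n) :
    1 / 48 * (n : ℝ) ^ 2 / Real.log n ^ 4 ≤ Var[partialSum (linProc coeff) n; whiteNoise] :=
  (le_cube_mul_coeff_sq hn).trans (le_variance_partialSum summable_coeff_sq
    (fun i => (coeff_pos i).le) antitone_coeff n)

theorem not_tendsto_variance_ratio :
    ¬ Tendsto (fun n => Var[partialSum (linProc coeff) (2 * n); whiteNoise] /
      Var[partialSum (linProc coeff) n; whiteNoise]) atTop (𝓝 2) :=
  not_tendsto_ratio_two (c := fun n => Var[partialSum (linProc coeff) n; whiteNoise])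
    (by norm_num : (0 : ℝ) < 1 / 48) (fun _ => variance_partialSum_pos)
    fun _ => le_variance_partialSum_coeff

theorem not_isRegularlyVarying_variance :
    ¬ IsRegularlyVarying (fun n => Var[partialSum (linProc coeff) n; whiteNoise]) 1 := by
  rintro ⟨-, h⟩
  have h2 := h 2 two_pos
  rw [Real.rpow_one] at h2
  refine not_tendsto_variance_ratio (h2.congr fun n => ?_)
  have : ⌊(2 : ℝ) * n⌋₊ = 2 * n := by
    rw [← Nat.floor_natCast (R := ℝ) (2 * n)]
    push_cast
    rfl
  simp only [this]

/-- The test functional is the cosine of the value at time 1/2, continuous for the uniform topology.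
Both sides being centred Gaussian, its expectations are `exp (-variance / 2)`, and taking logarithms
recovers the variances. -/
theorem tendsto_variance_ratio_of_invariancePrinciple
    (h : InvariancePrinciple whiteNoise (linProc coeff)) :
    Tendsto (fun n : ℕ => Var[partialSum (linProc coeff) ⌊(n : ℝ) * 2⁻¹⌋₊; whiteNoise] /
      Var[partialSum (linProc coeff) n; whiteNoise]) atTop (𝓝 2⁻¹) := by
  obtain ⟨Ω', mΩ', ν, W, hν, ⟨B, hB, hWB⟩, hconv⟩ := h
  let s : unitInterval := ⟨2⁻¹, by norm_num, by norm_num⟩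
  have hcont : Continuous fun x : DSpace => Real.cos (UniformFun.toFun x.1 s) :=
    Real.continuous_cos.comp
      ((UniformFun.uniformContinuous_eval ℝ s).continuous.comp continuous_subtype_val)
  let f : BoundedContinuousFunction DSpace ℝ :=
    BoundedContinuousFunction.ofNormedAddCommGroup _ hcont 1 fun x => by
      rw [Real.norm_eq_abs]
      exact Real.abs_cos_le_one _
  have hlim := hconv f
  have hW : ∫ ω, f (W ω) ∂ν = Real.exp (-(2⁻¹ / 2)) := by
    have hs := hB.toIsPreBrownianReal.hasLaw_eval (unitInterval.toNNReal s)
    have h1 := integral_cos_of_hasGaussianLaw hs.hasGaussianLaw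
      (hB.toIsPreBrownianReal.integral_eval _)
    rw [hs.variance_eq, variance_id_gaussianReal] at h1
    refine Eq.trans (integral_congr_ae ?_) h1
    filter_upwards [hWB] with ω hω
    simp only [f, BoundedContinuousFunction.coe_ofNormedAddCommGroup, hω s]
  have hZ : ∀ n : ℕ, ∫ ω, f (normalizedPath whiteNoise (linProc coeff) n ω) ∂whiteNoise =
      Real.exp (-(Var[partialSum (linProc coeff) ⌊(n : ℝ) * 2⁻¹⌋₊; whiteNoise] /
        Var[partialSum (linProc coeff) n; whiteNoise] / 2)) := by
    intro n
    have hg := (hasGaussianLaw_partialSum summable_coeff_sq ⌊(n : ℝ) * 2⁻¹⌋₊).fun_smul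
      (sigma whiteNoise (linProc coeff) n)⁻¹
    have h1 := integral_cos_of_hasGaussianLaw hg (by
      simp only [smul_eq_mul]
      rw [integral_const_mul, integral_partialSum summable_coeff_sq, mul_zero])
    simp only [smul_eq_mul] at h1
    have e : (sigma whiteNoise (linProc coeff) n)⁻¹ ^ 2 =
        (Var[partialSum (linProc coeff) n; whiteNoise])⁻¹ := by
      rw [inv_pow, sigma, Real.sq_sqrt (variance_nonneg _ _)]
    rw [variance_const_mul, e, inv_mul_eq_div] at h1
    exact h1
  rw [hW] at hlim
  simp only [hZ] at hlim
  have h2 := ((Real.continuousAt_log (Real.exp_ne_zero _)).tendsto.comp hlim).const_mul (-2)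
  simp only [Function.comp_def, Real.log_exp] at h2
  convert h2 using 2
  · ring
  · norm_num

theorem not_invariancePrinciple : ¬ InvariancePrinciple whiteNoise (linProc coeff) := by
  intro h
  -- Along even indices the integer part is exact, and the inverse ratio is the one already
  -- excluded.
  have h1 := (tendsto_variance_ratio_of_invariancePrinciple h).comp
    (tendsto_id.const_mul_atTop' two_pos : Tendsto (fun n : ℕ => 2 * n) atTop atTop)
  have h2 := h1.inv₀ (by norm_num)
  rw [inv_inv] at h2
  refine not_tendsto_variance_ratio (h2.congr fun n => ?_)
  have : ⌊((2 * n : ℕ) : ℝ) * 2⁻¹⌋₊ = n := by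
    have e : ((2 * n : ℕ) : ℝ) * 2⁻¹ = n := by
      push_cast
      ring
    rw [e, Nat.floor_natCast]
  simp only [Function.comp, this, inv_div]

end PartialSums

/-! ### Conditional expectations of the linear process -/

section CondExp

variable {t : ℕ → ℝ}

theorem condExp_block_eq_zero {Δ : Set ℤ} {k : ℤ} {s : Finset ℕ}
    (h : ∀ i ∈ s, k - (i : ℤ) ∉ Δ) :
    whiteNoise[block t k s | cylinderEvents (X := fun _ : ℤ => ℝ) Δ] =ᵐ[whiteNoise] 0 := by
  have hind : Indep (cylinderEvents (X := fun _ : ℤ => ℝ) Δᶜ) (cylinderEvents Δ) whiteNoise :=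
    indep_iSup_of_disjoint (fun i => (measurable_pi_apply i).comap_le) iIndepFun_eval
      disjoint_compl_left
  have hm : StronglyMeasurable[cylinderEvents (X := fun _ : ℤ => ℝ) Δᶜ] (block t k s) := by
    refine (Finset.measurable_sum _ fun i hi => Measurable.const_mul ?_ (t i)).stronglyMeasurable
    exact Measurable.eval_cylinderEvents (g := id) (h i hi) measurable_id
  refine (condExp_indep_eq cylinderEvents_le_pi cylinderEvents_le_pi hm hind).trans ?_
  rw [integral_block]
  rfl

/-- If the `n` latest innovations are invisible, the first `n` terms have conditional expectation
zero. Conditioning contracts the L² norm of the rest. -/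
theorem eLpNorm_condExp_linProc_le (ht : Summable fun i => t i ^ 2) {Δ : Set ℤ} {k : ℤ} {n : ℕ}
    (h : ∀ i < n, k - (i : ℤ) ∉ Δ) :
    eLpNorm (whiteNoise[linProc t k | cylinderEvents (X := fun _ : ℤ => ℝ) Δ]) 2 whiteNoise ≤
      ENNReal.ofReal (Real.sqrt (tailSq t n)) := by
  set b := block t k (Finset.range n)
  have h1 := condExp_sub ((memLp_linProc k ht).integrable one_le_two)
    ((memLp_block t k (Finset.range n)).integrable one_le_two)
    (cylinderEvents (X := fun _ : ℤ => ℝ) Δ)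
  have h2 : whiteNoise[linProc t k | cylinderEvents (X := fun _ : ℤ => ℝ) Δ] =ᵐ[whiteNoise]
      whiteNoise[linProc t k - b | cylinderEvents (X := fun _ : ℤ => ℝ) Δ] := by
    filter_upwards [h1, condExp_block_eq_zero (t := t) (s := Finset.range n)
      fun i hi => h i (Finset.mem_range.1 hi)] with ω h3 h4
    rw [h3, Pi.sub_apply, h4, Pi.zero_apply, sub_zero]
  rw [eLpNorm_congr_ae h2]
  exact (eLpNorm_condExp_le_eLpNorm _ one_le_two).trans (eLpNorm_linProc_sub_block_le k ht n)

theorem condExp_linProc_of_Iic_subset (ht : Summable fun i => t i ^ 2) {Δ : Set ℤ} {k : ℤ}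
    (h : Set.Iic k ⊆ Δ) :
    whiteNoise[linProc t k | cylinderEvents (X := fun _ : ℤ => ℝ) Δ] = linProc t k :=
  condExp_of_stronglyMeasurable cylinderEvents_le_pi
    (measurable_linProc k fun _ hi =>
      Measurable.eval_cylinderEvents (g := id) (h hi) measurable_id).stronglyMeasurable
    ((memLp_linProc k ht).integrable one_le_two)

end CondExp

/-! ### The filtration generated by the noise observed along a sparse grid -/

section GridFiltration

/-- The times `i` such that every grid point at or after `j` is at or after `i`. -/
def gridPast (G : ℤ → ℤ) (j : ℤ) : Set ℤ := {i | ∀ m, j ≤ G m → i ≤ G m}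

/-- At time `j` the noise is known up to the first grid point at or after `j`. -/
def gridFiltration (G : ℤ → ℤ) : Filtration ℤ (MeasurableSpace.pi : MeasurableSpace (ℤ → ℝ)) where
  seq j := cylinderEvents (X := fun _ : ℤ => ℝ) (gridPast G j)
  mono' _ _ h := cylinderEvents_mono fun _ hi m hm => hi m (h.trans hm)
  le' _ := cylinderEvents_le_pi

variable {G : ℤ → ℤ} {t : ℕ → ℝ}

theorem Iic_subset_gridPast (j : ℤ) : Set.Iic j ⊆ gridPast G j :=
  fun _ hi _ hm => le_trans hi hm

theorem adapted_gridFiltration : Adapted (gridFiltration G) (linProc t) := fun k =>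
  measurable_linProc k fun _ hi =>
    Measurable.eval_cylinderEvents (g := id) (Iic_subset_gridPast k hi) measurable_id

theorem gridPast_grid (m : ℤ) : gridPast G (G m) = Set.Iic (G m) :=
  Set.Subset.antisymm (fun _ hi => hi m le_rfl) (Iic_subset_gridPast _)

/-- Just after a grid point, the visible past jumps to the next one. -/
theorem gridPast_grid_add_one (hG : StrictMono G) (m : ℤ) :
    gridPast G (G m + 1) = Set.Iic (G (m + 1)) := by
  refine Set.Subset.antisymm (fun i hi => hi (m + 1) (hG (lt_add_one m))) fun i hi m' hm' => ?_
  have : m < m' := hG.lt_iff_lt.1 (by omega)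
  exact le_trans hi (hG.monotone (by omega))

theorem proj_eq_zero_of_notMem_range {j : ℤ} (hj : j - 1 ∉ Set.range G) (Z : (ℤ → ℝ) → ℝ) :
    proj whiteNoise (gridFiltration G) j Z = 0 := by
  have h : gridPast G (j - 1) = gridPast G j := by
    refine Set.Subset.antisymm (fun i hi m hm => hi m (by omega)) fun i hi m hm => hi m ?_
    have : j - 1 ≠ G m := fun h => hj ⟨m, h.symm⟩
    omega
  have h' : (gridFiltration G) (j - 1) = (gridFiltration G) j :=
    congrArg (cylinderEvents (X := fun _ : ℤ => ℝ)) h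
  rw [proj, h', sub_self]

theorem proj_grid_eq_zero (hG : StrictMono G) (ht : Summable fun i => t i ^ 2) {k m : ℤ}
    (hk : k ≤ G m) : proj whiteNoise (gridFiltration G) (G m + 1) (linProc t k) = 0 := by
  have h1 : whiteNoise[linProc t k | (gridFiltration G) (G m + 1)] = linProc t k :=
    condExp_linProc_of_Iic_subset ht (by
      rw [gridPast_grid_add_one hG]
      exact Set.Iic_subset_Iic.2 (hk.trans (hG (lt_add_one m)).le))
  have h2 : whiteNoise[linProc t k | (gridFiltration G) (G m)] = linProc t k :=
    condExp_linProc_of_Iic_subset ht (by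
      rw [gridPast_grid]
      exact Set.Iic_subset_Iic.2 hk)
  rw [proj, add_sub_cancel_right, h1, h2, sub_self]

/-- Both conditional expectations see no noise after `G (m + 1)`, so the triangle inequality
suffices. When `k ≤ G (m + 1)` the lag truncates to 0 and the bound is the trivial one. -/
theorem eLpNorm_proj_grid_le (hG : StrictMono G) (ht : Summable fun i => t i ^ 2) (k m : ℤ) :
    eLpNorm (proj whiteNoise (gridFiltration G) (G m + 1) (linProc t k)) 2 whiteNoise ≤
      ENNReal.ofReal (2 * Real.sqrt (tailSq t (k - G (m + 1)).toNat)) := by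
  have hlt := hG (lt_add_one m)
  have h1 : eLpNorm (whiteNoise[linProc t k | (gridFiltration G) (G m + 1)]) 2 whiteNoise ≤
      ENNReal.ofReal (Real.sqrt (tailSq t (k - G (m + 1)).toNat)) :=
    eLpNorm_condExp_linProc_le ht fun i hi => by
      rw [gridPast_grid_add_one hG, Set.mem_Iic]
      omega
  have h2 : eLpNorm (whiteNoise[linProc t k | (gridFiltration G) (G m)]) 2 whiteNoise ≤
      ENNReal.ofReal (Real.sqrt (tailSq t (k - G (m + 1)).toNat)) :=
    eLpNorm_condExp_linProc_le ht fun i hi => by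
      rw [gridPast_grid, Set.mem_Iic]
      omega
  rw [proj, add_sub_cancel_right, two_mul,
    ENNReal.ofReal_add (Real.sqrt_nonneg _) (Real.sqrt_nonneg _)]
  exact (eLpNorm_sub_le integrable_condExp.1 integrable_condExp.1 one_le_two).trans
    (add_le_add h1 h2)

theorem tsum_eLpNorm_proj_eq (hG : StrictMono G) (Z : (ℤ → ℝ) → ℝ) :
    ∑' j : ℤ, eLpNorm (proj whiteNoise (gridFiltration G) j Z) 2 whiteNoise =
      ∑' m : ℤ, eLpNorm (proj whiteNoise (gridFiltration G) (G m + 1) Z) 2 whiteNoise := by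
  have hinj : Function.Injective fun m => G m + 1 := fun a b h => hG.injective (by simpa using h)
  refine (hinj.tsum_eq (f := fun j =>
    eLpNorm (proj whiteNoise (gridFiltration G) j Z) 2 whiteNoise) fun j hj => ?_).symm
  by_contra hn
  refine hj ?_
  have : j - 1 ∉ Set.range G := by
    rintro ⟨m, hm⟩
    exact hn ⟨m, by simp [hm]⟩
  simp only [proj_eq_zero_of_notMem_range this, eLpNorm_zero]

/-- By the tower property through arbitrarily remote grid points, the norm is below every `√(tailSq
t n)`. -/
theorem condExp_iInf_gridFiltration (hbot : ∀ a, ∃ m, G m ≤ a) (ht : Summable fun i => t i ^ 2)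
    (k : ℤ) : whiteNoise[linProc t k | ⨅ i, gridFiltration G i] =ᵐ[whiteNoise] 0 := by
  have hle : ∀ n : ℕ, eLpNorm (whiteNoise[linProc t k | ⨅ i, gridFiltration G i]) 2 whiteNoise ≤
      ENNReal.ofReal (Real.sqrt (tailSq t n)) := by
    intro n
    obtain ⟨m, hm⟩ := hbot (k - n)
    have h1 := condExp_condExp_of_le (μ := whiteNoise) (f := linProc t k)
      (iInf_le (fun i => (gridFiltration G i : MeasurableSpace (ℤ → ℝ))) (G m))
      ((gridFiltration G).le (G m))
    rw [← eLpNorm_congr_ae h1]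
    refine (eLpNorm_condExp_le_eLpNorm _ one_le_two).trans ?_
    refine eLpNorm_condExp_linProc_le ht fun i hi => ?_
    rw [gridPast_grid, Set.mem_Iic]
    omega
  have h0 := le_antisymm (ge_of_tendsto' (tendsto_ofReal_sqrt_tailSq (t := t)) hle) bot_le
  exact (eLpNorm_eq_zero_iff integrable_condExp.1 two_ne_zero).1 h0

/-- The odd function on the integers extending `g` (for `g 0 = 0`). -/
def oddExtension (g : ℕ → ℤ) : ℤ → ℤ
  | .ofNat n => g n
  | .negSucc n => -g (n + 1)

theorem oddExtension_natCast (g : ℕ → ℤ) (n : ℕ) : oddExtension g (n : ℤ) = g n := rfl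

theorem oddExtension_neg_natCast {g : ℕ → ℤ} (h0 : g 0 = 0) (n : ℕ) :
    oddExtension g (-(n : ℤ)) = -g n := by
  cases n with
  | zero => simp [h0, oddExtension]
  | succ n => rfl

theorem strictMono_oddExtension {g : ℕ → ℤ} (h0 : g 0 = 0) (hg : StrictMono g) :
    StrictMono (oddExtension g) := by
  refine strictMono_int_of_lt_succ fun m => ?_
  obtain ⟨n, rfl | rfl⟩ := m.eq_nat_or_neg
  · exact hg n.lt_succ_self
  · cases n with
    | zero => exact hg Nat.zero_lt_one
    | succ n =>
      have e : -((n + 1 : ℕ) : ℤ) + 1 = -(n : ℤ) := by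
        push_cast
        ring
      rw [e, oddExtension_neg_natCast h0, oddExtension_neg_natCast h0]
      exact neg_lt_neg (hg n.lt_succ_self)

variable {g : ℕ → ℤ}

/-- If the gaps of the grid are long enough compared with the decay of the tails, the norms of the
projections decay geometrically, except for the two grid intervals up to time `k`. -/
theorem sqrt_tailSq_grid_le (ht : Summable fun i => t i ^ 2) (h0 : g 0 = 0) (hg : StrictMono g)
    (hgap : ∀ (n a : ℕ), g (n + 1) - g n ≤ a → Real.sqrt (tailSq t a) ≤ (1 / 2) ^ n)
    {k M m : ℤ} (hk : 0 ≤ k) (hM : oddExtension g M < k) (hm : m + 2 ≤ M) :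
    Real.sqrt (tailSq t (k - oddExtension g (m + 1)).toNat) ≤
      (4 + 2 * Real.sqrt (tailSq t 0)) * (1 / 2) ^ m.natAbs := by
  have hG := strictMono_oddExtension h0 hg
  have hs : 0 ≤ Real.sqrt (tailSq t 0) := Real.sqrt_nonneg _
  obtain ⟨n, rfl | rfl⟩ := m.eq_nat_or_neg
  -- Positive side: the whole gap from `g p` to `g (p + 1)` separates `G (m + 1)` from `k`, and `p ≥
  -- n`.
  · obtain ⟨p, rfl⟩ : ∃ p : ℕ, M = (p + 1 : ℕ) := ⟨(M - 1).toNat, by omega⟩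
    have h1 : oddExtension g ((n : ℤ) + 1) ≤ oddExtension g (p : ℤ) :=
      hG.monotone (by push_cast at hm; omega)
    rw [oddExtension_natCast] at hM
    rw [oddExtension_natCast g p] at h1
    have h2 := hgap p (k - oddExtension g ((n : ℤ) + 1)).toNat (by omega)
    have h3 : (1 / 2 : ℝ) ^ p ≤ (1 / 2) ^ n :=
      pow_le_pow_of_le_one (by norm_num) (by norm_num) (by push_cast at hm; omega)
    have h4 : (0 : ℝ) < (1 / 2) ^ n := by positivity
    rw [Int.natAbs_natCast]
    nlinarith
  · rw [Int.natAbs_neg, Int.natAbs_natCast]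
    rcases n with _ | _ | n
    -- For `m = 0` and `m = -1` no gap is available; the term `2 * √(tailSq t 0)` absorbs the
    -- trivial bound.
    · have h1 : Real.sqrt (tailSq t (k - oddExtension g (-((0 : ℕ) : ℤ) + 1)).toNat) ≤
          Real.sqrt (tailSq t 0) := Real.sqrt_le_sqrt (antitone_tailSq ht (Nat.zero_le _))
      rw [pow_zero]
      linarith
    · have h1 : Real.sqrt (tailSq t (k - oddExtension g (-((0 + 1 : ℕ) : ℤ) + 1)).toNat) ≤
          Real.sqrt (tailSq t 0) := Real.sqrt_le_sqrt (antitone_tailSq ht (Nat.zero_le _))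
      norm_num at h1 ⊢
      linarith
    -- Negative side: as `k ≥ 0`, the lag is at least `g (n + 1)`, which gives `(1 / 2) ^ n`. The
    -- exponent wanted is `n + 2`, hence the constant 4.
    · have e : -((n + 1 + 1 : ℕ) : ℤ) + 1 = -((n + 1 : ℕ) : ℤ) := by
        push_cast
        ring
      rw [e, oddExtension_neg_natCast h0]
      have hgn : 0 ≤ g n := h0 ▸ hg.monotone n.zero_le
      have h1 := hgap n (k - -g (n + 1)).toNat (by omega)
      refine h1.trans ?_
      have h4 : (0 : ℝ) < (1 / 2) ^ n := by positivity
      rw [pow_succ, pow_succ]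
      nlinarith

theorem summable_half_pow_natAbs : Summable fun m : ℤ => (1 / 2 : ℝ) ^ m.natAbs := by
  refine Summable.of_nat_of_neg ?_ ?_ <;> simpa using summable_geometric_two

theorem exists_grid_bracket (h0 : g 0 = 0) (hg : StrictMono g) (k : ℤ) :
    ∃ M, oddExtension g M < k ∧ k ≤ oddExtension g (M + 1) := by
  have hgn : ∀ n : ℕ, (n : ℤ) ≤ g n := by
    intro n
    induction n with
    | zero => simp [h0]
    | succ n ih =>
      have := hg (lt_add_one n)
      push_cast
      omega
  have hG := strictMono_oddExtension h0 hg
  have h1 : ∃ b : ℤ, ∀ z, oddExtension g z < k → z ≤ b := by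
    refine ⟨k.natAbs, fun z hz => ?_⟩
    by_contra! hlt
    have h2 := hG.monotone hlt.le
    rw [oddExtension_natCast] at h2
    have := hgn k.natAbs
    omega
  have h2 : ∃ z, oddExtension g z < k := by
    refine ⟨-((k.natAbs + 1 : ℕ) : ℤ), ?_⟩
    rw [oddExtension_neg_natCast h0]
    have := hgn (k.natAbs + 1)
    omega
  obtain ⟨M, hM, hmax⟩ := Int.exists_greatest_of_bdd h1 h2
  refine ⟨M, hM, ?_⟩
  by_contra! hlt
  have := hmax _ hlt
  omega

/-- With `k` between the grid points `M` and `M + 1`, the terms with `m > M` vanish, those at `M`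
and `M - 1` get the trivial bound, and the others are geometric. The total does not involve `k`. -/
theorem tsum_eLpNorm_proj_le (ht : Summable fun i => t i ^ 2) (h0 : g 0 = 0) (hg : StrictMono g)
    (hgap : ∀ (n a : ℕ), g (n + 1) - g n ≤ a → Real.sqrt (tailSq t a) ≤ (1 / 2) ^ n)
    {k : ℤ} (hk : 0 ≤ k) :
    ∑' j : ℤ, eLpNorm (proj whiteNoise (gridFiltration (oddExtension g)) j (linProc t k)) 2
        whiteNoise ≤
      ENNReal.ofReal (∑' m : ℤ, 2 * ((4 + 2 * Real.sqrt (tailSq t 0)) * (1 / 2) ^ m.natAbs)) +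
        ENNReal.ofReal (2 * Real.sqrt (tailSq t 0)) +
        ENNReal.ofReal (2 * Real.sqrt (tailSq t 0)) := by
  have hG := strictMono_oddExtension h0 hg
  obtain ⟨M, hM1, hM2⟩ := exists_grid_bracket h0 hg k
  set D := ENNReal.ofReal (2 * Real.sqrt (tailSq t 0))
  set r : ℤ → ℝ := fun m => 2 * ((4 + 2 * Real.sqrt (tailSq t 0)) * (1 / 2) ^ m.natAbs)
  have hb : ∀ m : ℤ, eLpNorm (proj whiteNoise (gridFiltration (oddExtension g))
      (oddExtension g m + 1) (linProc t k)) 2 whiteNoise ≤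
      ENNReal.ofReal (r m) + (if m = M then D else 0) + (if m = M - 1 then D else 0) := by
    intro m
    have hle := eLpNorm_proj_grid_le hG ht k m
    have hD : ENNReal.ofReal
        (2 * Real.sqrt (tailSq t (k - oddExtension g (m + 1)).toNat)) ≤ D := by
      refine ENNReal.ofReal_le_ofReal ?_
      have := Real.sqrt_le_sqrt (antitone_tailSq ht
        (Nat.zero_le (k - oddExtension g (m + 1)).toNat))
      linarith
    rcases lt_or_ge M m with h | h
    · rw [proj_grid_eq_zero hG ht (hM2.trans (hG.monotone (by omega))), eLpNorm_zero]
      exact bot_le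
    by_cases h1 : m = M
    · rw [if_pos h1]
      exact (hle.trans hD).trans (le_add_right le_add_self)
    by_cases h2 : m = M - 1
    · rw [if_pos h2]
      exact (hle.trans hD).trans le_add_self
    · rw [if_neg h1, if_neg h2, add_zero, add_zero]
      refine hle.trans (ENNReal.ofReal_le_ofReal ?_)
      have := sqrt_tailSq_grid_le ht h0 hg hgap hk hM1 (show m + 2 ≤ M by omega)
      exact mul_le_mul_of_nonneg_left this zero_le_two
  rw [tsum_eLpNorm_proj_eq hG]
  refine (ENNReal.tsum_le_tsum hb).trans ?_
  rw [ENNReal.tsum_add, ENNReal.tsum_add, tsum_ite_eq, tsum_ite_eq,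
    ENNReal.ofReal_tsum_of_nonneg (fun m => by positivity)
      ((summable_half_pow_natAbs.mul_left _).mul_left _)]

theorem exists_gaps (t : ℕ → ℝ) (ht : Summable fun i => t i ^ 2) :
    ∃ g : ℕ → ℤ, g 0 = 0 ∧ StrictMono g ∧
      ∀ (n a : ℕ), g (n + 1) - g n ≤ a → Real.sqrt (tailSq t a) ≤ (1 / 2) ^ n := by
  have h : ∀ n : ℕ, ∃ N : ℕ, Real.sqrt (tailSq t N) ≤ (1 / 2) ^ n := by
    intro n
    have h1 := (Real.continuous_sqrt.tendsto 0).comp (tendsto_tailSq (t := t))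
    rw [Real.sqrt_zero] at h1
    exact ((h1.eventually (gt_mem_nhds (by positivity : (0 : ℝ) < (1 / 2) ^ n))).exists).imp
      fun _ hN => le_of_lt hN
  choose N hN using h
  -- Gap `n` is `N n + 1`; the extra 1 makes the grid strictly increasing even when `N n = 0`.
  refine ⟨fun n => ∑ i ∈ Finset.range n, ((N i : ℤ) + 1), by simp, ?_, fun n a ha => ?_⟩
  · refine strictMono_nat_of_lt_succ fun n => ?_
    rw [Finset.sum_range_succ]
    omega
  · simp only [Finset.sum_range_succ] at ha
    exact (Real.sqrt_le_sqrt (antitone_tailSq ht (by omega : N n ≤ a))).trans (hN n)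

end GridFiltration

end ShortMemory

theorem proposition10 :
    ∃ (Ω : Type) (mΩ : MeasurableSpace Ω) (μ : Measure Ω) (t : ℕ → ℝ) (Y X : ℤ → Ω → ℝ)
      (F : Filtration ℤ mΩ),
      IsProbabilityMeasure μ ∧
      -- the innovations are i.i.d. standard normal
      iIndepFun Y μ ∧ (∀ i, HasLaw (Y i) (gaussianReal 0 1) μ) ∧
      -- the linear process
      (∀ i, 0 ≤ t i) ∧
      ShortMemory.IsCausalLinearProcess μ t Y X ∧
      ShortMemory.IsStrictlyStationary μ X ∧
      IsGaussianProcess X μ ∧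
      ShortMemory.IsPositivelyAssociated μ X ∧
      -- (i)
      Adapted F X ∧
      -- (ii)
      (∀ k, μ[X k | ⨅ i, F i] =ᵐ[μ] 0) ∧
      -- (iii)
      (⨆ k : ℕ, ∑' j : ℤ, eLpNorm (ShortMemory.proj μ F j (X (k : ℤ))) 2 μ) < ∞ ∧
      -- (iv)
      (∀ n : ℕ, 1 ≤ n → 0 < variance (ShortMemory.partialSum X n) μ) ∧
      ¬ ShortMemory.IsRegularlyVarying
          (fun n => variance (ShortMemory.partialSum X n) μ) 1 ∧
      (∃ c : ℝ, 0 < c ∧ ∃ k : ℕ → ℕ, StrictMono k ∧ (∀ r, 2 ≤ k r) ∧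
        ∀ r, c * (k r : ℝ) ^ 2 / Real.log (k r) ^ 4 ≤
          variance (ShortMemory.partialSum X (k r)) μ) ∧
      -- (v)
      ¬ ShortMemory.InvariancePrinciple μ X := by
  have ht := ShortMemory.summable_coeff_sq
  have hnn : ∀ i, 0 ≤ ShortMemory.coeff i := fun i => (ShortMemory.coeff_pos i).le
  obtain ⟨g, h0, hg, hgap⟩ := ShortMemory.exists_gaps _ ht
  refine ⟨ℤ → ℝ, inferInstance, ShortMemory.whiteNoise, ShortMemory.coeff, fun i ω => ω i,
    ShortMemory.linProc ShortMemory.coeff,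
    ShortMemory.gridFiltration (ShortMemory.oddExtension g), inferInstance,
    ShortMemory.iIndepFun_eval, ShortMemory.hasLaw_eval, hnn,
    ShortMemory.isCausalLinearProcess_linProc ht, ShortMemory.isStrictlyStationary_linProc,
    ShortMemory.isGaussianProcess_linProc ht, ShortMemory.isPositivelyAssociated_linProc hnn,
    ShortMemory.adapted_gridFiltration, ?_, ?_, fun n => ShortMemory.variance_partialSum_pos,
    ShortMemory.not_isRegularlyVarying_variance,
    ⟨1 / 48, by norm_num, fun r => r + 3, fun a b h => Nat.add_lt_add_right h 3,
      fun r => Nat.le_add_left 2 (r + 1),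
      fun r => ShortMemory.le_variance_partialSum_coeff (Nat.le_add_left 3 r)⟩,
    ShortMemory.not_invariancePrinciple⟩
  · refine ShortMemory.condExp_iInf_gridFiltration (fun a => ?_) ht
    obtain ⟨M, hM, -⟩ := ShortMemory.exists_grid_bracket h0 hg a
    exact ⟨M, hM.le⟩
  · refine lt_of_le_of_lt (iSup_le fun k => ShortMemory.tsum_eLpNorm_proj_le ht h0 hg hgap
      (Int.natCast_nonneg k)) ?_
    exact ENNReal.add_lt_top.2 ⟨ENNReal.add_lt_top.2
      ⟨ENNReal.ofReal_lt_top, ENNReal.ofReal_lt_top⟩, ENNReal.ofReal_lt_top⟩
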